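/- Let $X$ be a complex Banach space, let $0<\delta<\pi/2$ and $M>0$, and put $\Sigma_\delta=\{z\in\mathbb C: |\arg(-z)|\le\delta\}$ (with $0\in\Sigma_\delta$). Let $u:(0,\infty)\to X$ be such that $e^{-\omega t}u(t)$ is integrable on $(0,\infty)$ for some $\omega\in\mathbb R$, and suppose that its Laplace transform $U(z)=\int_0^\infty e^{-zt}u(t)\,dt$ (defined for $\operatorname{Re}z$ large) extends holomorphically to $\mathbb C\setminus\Sigma_\delta$ with $\|U(z)\|\le M/|z|$ for $z\notin\Sigma_\delta$. Then $u$ agrees almost everywhere with a continuous function on $(0,\infty)$, again denoted by $u$, for which the following holds. Let $\alpha,d>0$ satisfy $0<\alpha-d<\alpha+d<\frac{\pi}{2}-\delta$, and let $t_0>0$, $\Lambda\ge1$, $0<\theta<1$, $n\in\mathbb N$, $n\ge1$, $\rho>0$. Set $$a(\theta)=\operatorname{arccosh}\Big(\frac{\Lambda}{(1-\theta)\sin\alpha}\Big),\qquad h=\frac{a(\theta)}{n},\qquad \lambda=\frac{2\pi d n(1-\theta)}{t_0\Lambda a(\theta)},\qquad \epsilon_n(\theta)=\exp\Big(-\frac{2\pi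 d}{a(\theta)}n\Big),$$ $T(w)=1-\sin(\alpha+iw)$, $L(x)=1+|\ln(1-e^{-x})|$, and, for $-n\le k\le n$, $$x_k=kh,\qquad z_k=\lambda T(x_k),\qquad \omega_k^*(t)=-\frac{\lambda h}{2\pi i}\,e^{t z_k}\,T'(x_k).$$ Let $\omega_k(t)\in\mathbb C$ ($t_0\le t\le\Lambda t_0$) and $U_k\in X$ ($-n\le k\le n$), and put $\bar u_n(t)=\sum_{k=-n}^{n}\omega_k(t)U_k$. Suppose that either (a) (absolute error) for all $-n\le k\le n$ and $t\in[t_0,\Lambda t_0]$: $\|U(z_k)-U_k\|\le\rho$ and $\omega_k(t)=\omega_k^*(t)$; or (b) (relative error) for all $-n\le k\le n$ and $t\in[t_0,\Lambda t_0]$: $\|\omega_k^*(t)U(z_k)-\omega_k(t)U_k\|\le\rho\,\|\omega_k^*(t)U(z_k)\|$. Then, for every $t\in[t_0,\Lambda t_0]$, $$\|u(t)-\bar u_n(t)\|\le M\,\Phi\,Q\,\Big(\varepsilon\,\epsilon_n(\theta)^{\theta-1}+\frac{\epsilon_n(\theta)^{\theta}}{1-\epsilon_n(\theta)}\Big),$$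 where in case (a) $\varepsilon=\rho/(Mt_0)$, $$\Phi=\max\Big\{\frac2\pi\sqrt{\frac{1+\sin(\alpha+d)}{1-\sin(\alpha+d)}},\ \frac{1}{\pi e\sin\alpha}\Big\},$$ $$Q=\max\Big\{2L(\lambda t_0\sin(\alpha-d)),\ \frac{\ln n}{\ln n-1}\Big[\frac{\ln n}{2n}+L\Big(\frac{\lambda t_0\sin\alpha}{\ln n}\Big)\Big]\Big\}$$ (for $n=1$ the second entry of this maximum is read as $0$), and in case (b) $\varepsilon=\rho$, $$\Phi=\frac2\pi\sqrt{\frac{1+\sin(\alpha+d)}{1-\sin(\alpha+d)}},\qquad Q=\max\Big\{2L(\lambda t_0\sin(\alpha-d)),\ \tfrac12\big(h+L(\lambda t_0\sin\alpha)\big)\Big\}.$$ -/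

import Mathlib

open Set MeasureTheory

noncomputable section

namespace LaplaceInversion

/-- The closed sector `{z : |arg (-z)| ≤ δ}` around the negative real axis (it contains `0`). -/
def sector (δ : ℝ) : Set ℂ := {z | |Complex.arg (-z)| ≤ δ}

/-- `u : (0, ∞) → X` is locally integrable with exponential growth (in the weak sense that
`e^{-ωt} u(t)` is integrable on `(0, ∞)` for some `ω`), and `U` coincides with its Laplace transform
on some right half plane. Values of `u` outside `(0, ∞)` are irrelevant. -/
def IsLaplaceTransform {X : Type*} [NormedAddCommGroup X] [NormedSpace ℂ X]
    (u : ℝ → X) (U : ℂ → X) : Prop :=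
  ∃ ω : ℝ, IntegrableOn (fun t : ℝ => Complex.exp (-(ω * t)) • u t) (Ioi 0) ∧
    ∀ z : ℂ, ω < z.re → U z = ∫ t in Ioi (0 : ℝ), Complex.exp (-(z * t)) • u t

/-- `U` is holomorphic outside the sector and satisfies `‖U z‖ ≤ M / |z|` there. -/
def IsSectorial {X : Type*} [NormedAddCommGroup X] [NormedSpace ℂ X]
    (δ M : ℝ) (U : ℂ → X) : Prop :=
  DifferentiableOn ℂ U (sector δ)ᶜ ∧ ∀ z ∉ sector δ, ‖U z‖ ≤ M / ‖z‖

/-- `T(w) = 1 - sin (α + i w)`, parametrizing a branch of a hyperbola for real `w`. -/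
def T (α : ℝ) (w : ℂ) : ℂ := 1 - Complex.sin (α + Complex.I * w)

/-- `L(x) = 1 + |ln (1 - e^{-x})|`. -/
def L (x : ℝ) : ℝ := 1 + |Real.log (1 - Real.exp (-x))|

/-- `a(θ) = arccosh (Λ / ((1 - θ) sin α))`. -/
def a (α Λ θ : ℝ) : ℝ := Real.arcosh (Λ / ((1 - θ) * Real.sin α))

/-- The step size `h = a(θ) / n`. -/
def step (α Λ θ : ℝ) (n : ℕ) : ℝ := 1 / n * a α Λ θ

/-- The scale parameter `λ = 2 π d n (1 - θ) / (t₀ Λ a(θ))`. -/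
def scale (α d t₀ Λ θ : ℝ) (n : ℕ) : ℝ :=
  2 * Real.pi * d * n * (1 - θ) / (t₀ * Λ * a α Λ θ)

/-- `ε_n(θ) = exp (-2 π d n / a(θ))`. -/
def eps (α d Λ θ : ℝ) (n : ℕ) : ℝ := Real.exp (-(2 * Real.pi * d / a α Λ θ) * n)

/-- The node `z_k = λ T(k h)`. -/
def node (α h lam : ℝ) (k : ℤ) : ℂ := lam * T α (k * h)

/-- The exact quadrature weight `-(λ h / (2 π i)) exp (t z_k) T'(k h)`. -/
def weight (α h lam t : ℝ) (k : ℤ) : ℂ :=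
  -(lam * h / (2 * Real.pi * Complex.I)) * Complex.exp (t * node α h lam k) * deriv (T α) (k * h)

/-- The computed approximation `ū_n(t) = ∑_{k=-n}^{n} ω_k(t) U_k`. -/
def computed {X : Type*} [NormedAddCommGroup X] [NormedSpace ℂ X]
    (n : ℕ) (w : ℤ → ℝ → ℂ) (V : ℤ → X) (t : ℝ) : X :=
  ∑ k ∈ Finset.Icc (-(n : ℤ)) n, w k t • V k

/-- Absolute error `ρ`: at all nodes the value of `U` is known up to `ρ`, and the weights are exact
for every `t ∈ J`. -/
def AbsoluteError {X : Type*} [NormedAddCommGroup X] [NormedSpace ℂ X]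
    (α h lam : ℝ) (n : ℕ) (J : Set ℝ) (ρ : ℝ) (U : ℂ → X) (w : ℤ → ℝ → ℂ) (V : ℤ → X) : Prop :=
  ∀ k ∈ Finset.Icc (-(n : ℤ)) n,
    ‖U (node α h lam k) - V k‖ ≤ ρ ∧ ∀ t ∈ J, w k t = weight α h lam t k

/-- Relative error `ρ` in each term of the quadrature sum, for every `t ∈ J`. -/
def RelativeError {X : Type*} [NormedAddCommGroup X] [NormedSpace ℂ X]
    (α h lam : ℝ) (n : ℕ) (J : Set ℝ) (ρ : ℝ) (U : ℂ → X) (w : ℤ → ℝ → ℂ) (V : ℤ → X) : Prop :=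
  ∀ k ∈ Finset.Icc (-(n : ℤ)) n, ∀ t ∈ J,
    ‖weight α h lam t k • U (node α h lam k) - w k t • V k‖ ≤
      ρ * ‖weight α h lam t k • U (node α h lam k)‖

/-- `φ(α, d) = (2 / π) √((1 + sin (α + d)) / (1 - sin (α + d)))`. -/
def phi (α d : ℝ) : ℝ :=
  2 / Real.pi * √((1 + Real.sin (α + d)) / (1 - Real.sin (α + d)))

/-- The constant `Φ` for absolute errors. -/
def PhiAbs (α d : ℝ) : ℝ := max (phi α d) (1 / (Real.pi * Real.exp 1 * Real.sin α))

/-- The constant `Q` for absolute errors. For `n = 1` the factor `ln n / (ln n - 1)` is `0`, so the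
second entry of the maximum is `0` whatever the value of `L` next to it. -/
def QAbs (α d lam t₀ : ℝ) (n : ℕ) : ℝ :=
  max (2 * L (lam * t₀ * Real.sin (α - d)))
    (Real.log n / (Real.log n - 1) *
      (Real.log n / (2 * n) + L (lam * t₀ * Real.sin α / Real.log n)))

/-- The constant `Q` for relative errors. -/
def QRel (α d h lam t₀ : ℝ) : ℝ :=
  max (2 * L (lam * t₀ * Real.sin (α - d))) (1 / 2 * (h + L (lam * t₀ * Real.sin α)))

end LaplaceInversion

end

noncomputable section

namespace LaplaceInversion

open Filter Topology

/-! The continuous representative is `inversion`, the integral of `e^{tz} U(z)` over the hyperbola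
`z = λ T(x)`. Its Laplace transform at a real `s ≥ λ` becomes, by Fubini, a Cauchy integral with
value `U(s)` (`integral_resolvent_smul_contourIntegrand`, `laplace_inversion`). A function is
determined a.e. by its transform on an arithmetic progression (`ae_eq_zero_of_laplace_nat`), so
`inversion` equals `u` a.e. and, by continuity, does not depend on `α` and `λ` (`inversion_eq`).

Moving `x` to `x + iy` turns `α` into `α - y`. Hence the integrand is holomorphic for `|y| ≤ d`,
with a bound of the form `C e^{λt} exp(-λt sin(α - y) cosh x)`. Poisson summation and a shift of the
Fourier integrals to the edges of the strip bound the trapezoidal error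
(`norm_tsum_sub_integral_le`). Truncation costs a factor `exp(-λt sin α cosh(nh))`, and all
remaining integrals are controlled by `∫_0^∞ exp(-γ cosh x) dx ≤ L(γ)`. Write `ε_n = e^{-K}` with `K
= 2πd/h`. The parameters give `λΛt₀ = (1-θ)K` and `sin α cosh(nh) = Λ/(1-θ)`, whence `e^{λt} ≤
ε_n^{θ-1}` on the whole time interval and a truncation factor at most `ε_n^θ`
(`norm_inversion_sub_sum_le`).

Data errors are amplified by a sum over the nodes. For relative errors it is compared with the same
integral (`sum_norm_contourIntegrand_le`). For absolute errors the terms are `γ cosh(kh) exp(-γ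
cosh(kh))`, which are not monotone. Small steps are treated by a telescoping majorant and large
steps by the geometric growth of `cosh(kh)` (`mul_sum_mul_cosh_mul_exp_div_le`). The outcome is a
multiple of `2 L(γ)`, so the first entry of the maximum `QAbs` alone suffices. -/

/-! ### Geometry of the sector and of the hyperbolas. -/

lemma notMem_sector {δ : ℝ} (hδ : 0 < δ) (hδ' : δ < Real.pi / 2) {z : ℂ} :
    z ∉ sector δ ↔ -z.re < ‖z‖ * Real.cos δ := by
  rw [← not_le, not_iff_not]
  rcases eq_or_ne z 0 with rfl | hz
  · simp [sector, hδ.le]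
  have hre : ‖z‖ * Real.cos (Complex.arg (-z)) = -z.re := by
    have := Complex.norm_mul_cos_arg (-z)
    simpa using this
  have hpos : 0 < ‖z‖ := norm_pos_iff.2 hz
  rw [← hre, mul_le_mul_iff_right₀ hpos, ← Real.cos_abs (Complex.arg (-z))]
  exact (Real.strictAntiOn_cos.le_iff_ge ⟨hδ.le, by linarith⟩
    ⟨abs_nonneg _, Complex.abs_arg_le_pi _⟩).symm

lemma isOpen_compl_sector {δ : ℝ} (hδ : 0 < δ) (hδ' : δ < Real.pi / 2) :
    IsOpen (sector δ)ᶜ := by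
  have : (sector δ)ᶜ = {z : ℂ | -z.re < ‖z‖ * Real.cos δ} := by
    ext z; exact notMem_sector hδ hδ'
  rw [this]
  exact isOpen_lt (by fun_prop) (by fun_prop)

lemma notMem_sector_of_pos {δ : ℝ} (hδ : 0 < δ) (hδ' : δ < Real.pi / 2) {s : ℝ} (hs : 0 < s) :
    (s : ℂ) ∉ sector δ := by
  rw [notMem_sector hδ hδ']
  have : 0 < Real.cos δ := Real.cos_pos_of_mem_Ioo ⟨by linarith, hδ'⟩
  have h2 : 0 < ‖(s : ℂ)‖ := by simpa using hs.ne'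
  simp only [Complex.ofReal_re]
  nlinarith [mul_pos h2 this]

/-- Horizontal lines in the parameter plane are again branches of hyperbolas, with another angle;
every estimate in the strip thus reduces to one on the real line. -/
lemma T_add_mul_I (α x y : ℝ) : T α (x + y * Complex.I) = T (α - y) x := by
  simp only [T]
  congr 2
  push_cast
  linear_combination (y : ℂ) * Complex.I_sq

lemma T_re (β x : ℝ) : (T β x).re = 1 - Real.sin β * Real.cosh x := by
  rw [T, mul_comm Complex.I, Complex.sin_add_mul_I]
  simp [← Complex.ofReal_sin, ← Complex.ofReal_cos, ← Complex.ofReal_cosh, ← Complex.ofReal_sinh]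

lemma T_im (β x : ℝ) : (T β x).im = -(Real.cos β * Real.sinh x) := by
  rw [T, mul_comm Complex.I, Complex.sin_add_mul_I]
  simp [← Complex.ofReal_sin, ← Complex.ofReal_cos, ← Complex.ofReal_cosh, ← Complex.ofReal_sinh]

lemma norm_T (β x : ℝ) : ‖T β x‖ = Real.cosh x - Real.sin β := by
  have h1 : 0 ≤ Real.cosh x - Real.sin β := by
    linarith [Real.one_le_cosh x, Real.sin_le_one β]
  rw [← sq_eq_sq₀ (norm_nonneg _) h1, Complex.sq_norm, Complex.normSq_apply, T_re, T_im]
  linear_combination (Real.sinh x ^ 2) * Real.sin_sq_add_cos_sq β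
    - (1 - Real.sin β ^ 2) * Real.cosh_sq x

/-- The derivative of `T β`. -/
def T' (β : ℝ) (w : ℂ) : ℂ := -(Complex.I * Complex.cos (β + Complex.I * w))

lemma hasDerivAt_T (β : ℝ) (w : ℂ) : HasDerivAt (T β) (T' β w) w := by
  have h : HasDerivAt (fun w : ℂ => (β : ℂ) + Complex.I * w) Complex.I w := by
    simpa using ((hasDerivAt_id w).const_mul Complex.I).const_add (β : ℂ)
  rw [T', mul_comm Complex.I (Complex.cos _)]
  exact (h.csin).const_sub 1

lemma deriv_T (β : ℝ) : deriv (T β) = T' β := funext fun w => (hasDerivAt_T β w).deriv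

lemma T'_add_mul_I (α x y : ℝ) : T' α (x + y * Complex.I) = T' (α - y) x := by
  simp only [T']
  congr 3
  push_cast
  linear_combination (y : ℂ) * Complex.I_sq

lemma differentiable_T (β : ℝ) : Differentiable ℂ (T β) :=
  fun w => (hasDerivAt_T β w).differentiableAt

lemma differentiable_T' (β : ℝ) : Differentiable ℂ (T' β) := by
  unfold T'; fun_prop

lemma norm_T'_sq (β x : ℝ) :
    ‖T' β x‖ ^ 2 = (Real.cosh x - Real.sin β) * (Real.cosh x + Real.sin β) := by
  rw [T', norm_neg, norm_mul, Complex.norm_I, one_mul, mul_comm Complex.I, Complex.cos_add_mul_I,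
    Complex.sq_norm, Complex.normSq_apply]
  simp [← Complex.ofReal_sin, ← Complex.ofReal_cos, ← Complex.ofReal_cosh, ← Complex.ofReal_sinh]
  linear_combination (Real.cosh x ^ 2) * Real.sin_sq_add_cos_sq β
    - Real.sin β ^ 2 * Real.cosh_sq x

lemma norm_T'_le_cosh (β x : ℝ) : ‖T' β x‖ ≤ Real.cosh x := by
  refine le_of_sq_le_sq ?_ (Real.cosh_pos x).le
  rw [norm_T'_sq]
  nlinarith [sq_nonneg (Real.sin β)]

/-- The squared ratio is `(cosh x + sin β) / (cosh x - sin β)`, which increases with `sin β` and,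
once `sin β` is replaced by `s ≥ 0`, is largest at `x = 0`. The free `s` permits one constant, `s =
sin(α + d)`, for the whole strip. -/
lemma norm_T'_le {β s : ℝ} (x : ℝ) (h : Real.sin β ≤ s) (hs0 : 0 ≤ s) (hs : s < 1) :
    ‖T' β x‖ ≤ √((1 + s) / (1 - s)) * ‖T β x‖ := by
  have h1 : 0 < 1 - s := by linarith
  have h0 := Real.neg_one_le_sin β
  have h2 : 0 ≤ (1 + s) / (1 - s) := div_nonneg (by linarith) h1.le
  have hc := Real.one_le_cosh x
  refine le_of_sq_le_sq ?_ (by positivity)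
  rw [mul_pow, Real.sq_sqrt h2, norm_T'_sq, norm_T, div_mul_eq_mul_div, le_div_iff₀ h1]
  have h3 : 0 ≤ Real.cosh x - Real.sin β := by linarith
  have : (Real.cosh x + Real.sin β) * (1 - s) ≤ (1 + s) * (Real.cosh x - Real.sin β) := by
    nlinarith
  nlinarith

lemma smul_T_notMem_sector {δ : ℝ} (hδ : 0 < δ) (hδ' : δ < Real.pi / 2) {lam β : ℝ}
    (hlam : 0 < lam) (hβ : Real.sin β < Real.cos δ) (x : ℝ) : (lam * T β x : ℂ) ∉ sector δ := by
  rw [notMem_sector hδ hδ', Complex.re_ofReal_mul, norm_mul, T_re, norm_T,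
    Complex.norm_of_nonneg hlam.le]
  have hc := Real.one_le_cosh x
  have h1 : Real.sin β < 1 := hβ.trans_le (Real.cos_le_one _)
  have : -(1 - Real.sin β * Real.cosh x) < (Real.cosh x - Real.sin β) * Real.cos δ := by
    nlinarith [Real.neg_one_le_sin β]
  nlinarith

/-! ### Shifting the line of integration. -/

section Shift

variable {E : Type*} [NormedAddCommGroup E] [NormedSpace ℂ E]

lemma tendsto_integral_line_sub {f : ℂ → E} {b R₀ : ℝ} {B : ℝ → ℝ}
    (hf : DifferentiableOn ℂ f {z | z.im ∈ uIcc 0 b}) (hB : Tendsto B atTop (𝓝 0))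
    (hfB : ∀ x y : ℝ, y ∈ uIcc 0 b → R₀ ≤ |x| → ‖f (x + y * Complex.I)‖ ≤ B |x|) :
    Tendsto (fun R : ℝ => (∫ x in -R..R, f x) - ∫ x in -R..R, f (x + b * Complex.I))
      atTop (𝓝 0) := by
  have key : ∀ R : ℝ, (∫ x in -R..R, f x) - (∫ x in -R..R, f (x + b * Complex.I)) =
      Complex.I • (∫ y in (0 : ℝ)..b, f (((-R : ℝ) : ℂ) + y * Complex.I)) -
      Complex.I • (∫ y in (0 : ℝ)..b, f ((R : ℂ) + y * Complex.I)) := by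
    intro R
    have := Complex.integral_boundary_rect_eq_zero_of_differentiableOn f ((-R : ℝ) : ℂ)
      ((R : ℂ) + b * Complex.I) (hf.mono ?_)
    · simp only [Complex.ofReal_re, Complex.add_re, Complex.mul_re, Complex.I_re, mul_zero,
        Complex.ofReal_im, Complex.I_im, mul_one, sub_self, add_zero, Complex.add_im,
        Complex.mul_im, zero_add, Complex.ofReal_zero, zero_mul] at this
      rw [← sub_eq_zero, ← this]
      abel
    · intro z hz
      simpa using hz.2
  have hb : ∀ s : ℝ, |s| = 1 → Tendsto (fun R : ℝ =>
      Complex.I • (∫ y in (0 : ℝ)..b, f (((s * R : ℝ) : ℂ) + y * Complex.I))) atTop (𝓝 0) := by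
    intro s hs
    have h0 : Tendsto (fun R => B R * |b - 0|) atTop (𝓝 0) := by
      simpa using hB.mul_const |b - 0|
    refine squeeze_zero_norm' ?_ h0
    filter_upwards [eventually_ge_atTop R₀, eventually_ge_atTop 0] with R hR hR0
    have habs : |s * R| = R := by rw [abs_mul, hs, one_mul, abs_of_nonneg hR0]
    rw [norm_smul, Complex.norm_I, one_mul]
    refine intervalIntegral.norm_integral_le_of_norm_le_const fun y hy => ?_
    have := hfB (s * R) y (uIoc_subset_uIcc hy) (by rwa [habs])
    rwa [habs] at this
  have h1 := (hb (-1) (by simp)).sub (hb 1 (by simp))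
  rw [sub_zero] at h1
  refine h1.congr fun R => ?_
  rw [key]
  simp

lemma integral_line_eq {f : ℂ → E} {b R₀ : ℝ} {B : ℝ → ℝ}
    (hf : DifferentiableOn ℂ f {z | z.im ∈ uIcc 0 b}) (hB : Tendsto B atTop (𝓝 0))
    (hfB : ∀ x y : ℝ, y ∈ uIcc 0 b → R₀ ≤ |x| → ‖f (x + y * Complex.I)‖ ≤ B |x|)
    (h0 : Integrable fun x : ℝ => f x) (h1 : Integrable fun x : ℝ => f (x + b * Complex.I)) :
    ∫ x : ℝ, f x = ∫ x : ℝ, f (x + b * Complex.I) := by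
  have h := tendsto_integral_line_sub hf hB hfB
  have h2 := (intervalIntegral_tendsto_integral h0 tendsto_neg_atTop_atBot tendsto_id).sub
    (intervalIntegral_tendsto_integral h1 tendsto_neg_atTop_atBot tendsto_id)
  exact sub_eq_zero.1 (tendsto_nhds_unique h2 h)

end Shift

lemma tendsto_const_mul_inv_one_add_sq (C : ℝ) :
    Tendsto (fun x : ℝ => C * (1 + x ^ 2)⁻¹) atTop (𝓝 0) := by
  have : Tendsto (fun x : ℝ => (1 + x ^ 2)⁻¹) atTop (𝓝 0) :=
    tendsto_inv_atTop_zero.comp (tendsto_atTop_add_const_left _ _ (tendsto_pow_atTop two_ne_zero))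
  simpa using this.const_mul C

/-! ### The trapezoidal rule in a strip, by Poisson summation. -/

section Trapezoid

variable {E : Type*} [NormedAddCommGroup E] [NormedSpace ℂ E]

lemma continuous_line {f : ℂ → E} {d : ℝ} (hf : DifferentiableOn ℂ f {z | |z.im| ≤ d})
    {y : ℝ} (hy : |y| ≤ d) : Continuous fun x : ℝ => f (x + y * Complex.I) := by
  refine hf.continuousOn.comp_continuous (by fun_prop) fun x => ?_
  simpa using hy

lemma integrable_line {f : ℂ → E} {d C : ℝ} (hf : DifferentiableOn ℂ f {z | |z.im| ≤ d})
    (hfC : ∀ x y : ℝ, |y| ≤ d → ‖f (x + y * Complex.I)‖ ≤ C * (1 + x ^ 2)⁻¹)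
    {y : ℝ} (hy : |y| ≤ d) : Integrable fun x : ℝ => f (x + y * Complex.I) := by
  refine (integrable_inv_one_add_sq.const_mul C).mono'
    (continuous_line hf hy).aestronglyMeasurable (Eventually.of_forall fun x => hfC x y hy)

lemma norm_fourier_line_le {g : ℂ → ℂ} {d C N : ℝ}
    (hg : DifferentiableOn ℂ g {z | |z.im| ≤ d})
    (hgC : ∀ x y : ℝ, |y| ≤ d → ‖g (x + y * Complex.I)‖ ≤ C * (1 + x ^ 2)⁻¹)
    {y : ℝ} (hy : |y| ≤ d) (hN : ∫ x : ℝ, ‖g (x + y * Complex.I)‖ ≤ N) (m : ℝ) :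
    ‖∫ x : ℝ, Complex.exp (-(2 * Real.pi * m * x) * Complex.I) * g x‖ ≤
      N * Real.exp (2 * Real.pi * m * y) := by
  have hnorm : ∀ x t : ℝ, ‖Complex.exp (-(2 * Real.pi * m * (x + t * Complex.I)) * Complex.I)‖ =
      Real.exp (2 * Real.pi * m * t) := by
    intro x t
    rw [Complex.norm_exp]
    congr 1
    simp
  have hsub : ∀ t ∈ uIcc 0 y, |t| ≤ d := by
    intro t ht
    refine le_trans ?_ hy
    rcases le_total 0 y with h | h
    · rw [uIcc_of_le h] at ht
      rw [abs_of_nonneg ht.1, abs_of_nonneg h]; exact ht.2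
    · rw [uIcc_of_ge h] at ht
      rw [abs_of_nonpos ht.2, abs_of_nonpos h]; linarith [ht.1]
  set f : ℂ → ℂ := fun w => Complex.exp (-(2 * Real.pi * m * w) * Complex.I) * g w with hfdef
  have hfd : DifferentiableOn ℂ f {z | |z.im| ≤ d} := by
    refine DifferentiableOn.mul (Differentiable.differentiableOn ?_) hg
    fun_prop
  set K := Real.exp (|2 * Real.pi * m| * d)
  have hC0 : ∀ x : ℝ, 0 ≤ C * (1 + x ^ 2)⁻¹ := fun x => (norm_nonneg _).trans (hgC x y hy)
  have hfC : ∀ x t : ℝ, |t| ≤ d → ‖f (x + t * Complex.I)‖ ≤ (K * C) * (1 + x ^ 2)⁻¹ := by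
    intro x t ht
    rw [hfdef]
    simp only [norm_mul, hnorm]
    rw [mul_assoc K]
    refine mul_le_mul (Real.exp_le_exp.2 ?_) (hgC x t ht) (norm_nonneg _) (Real.exp_pos _).le
    calc _ ≤ |2 * Real.pi * m * t| := le_abs_self _
      _ = |2 * Real.pi * m| * |t| := abs_mul _ _
      _ ≤ _ := by gcongr
  have hd : |(0 : ℝ)| ≤ d := by simpa using (abs_nonneg y).trans hy
  have h0 : Integrable fun x : ℝ => f x := by simpa using integrable_line hfd hfC hd
  have hshift := integral_line_eq (b := y) (R₀ := 0) (hfd.mono fun z hz => hsub _ hz)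
    (tendsto_const_mul_inv_one_add_sq (K * C))
    (fun x t ht _ => by simpa using hfC x t (hsub t ht)) h0 (integrable_line hfd hfC hy)
  calc _ = ‖∫ x : ℝ, f (x + y * Complex.I)‖ := by rw [← hshift]
    _ ≤ ∫ x : ℝ, ‖f (x + y * Complex.I)‖ := norm_integral_le_integral_norm _
    _ = ∫ x : ℝ, Real.exp (2 * Real.pi * m * y) * ‖g (x + y * Complex.I)‖ := by
      simp only [hfdef, norm_mul, hnorm]
    _ = Real.exp (2 * Real.pi * m * y) * ∫ x : ℝ, ‖g (x + y * Complex.I)‖ :=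
      integral_const_mul _ _
    _ ≤ _ := by rw [mul_comm]; gcongr

lemma norm_tsum_sub_integral_le_scalar {g : ℂ → ℂ} {d C N : ℝ} (hd : 0 < d)
    (hg : DifferentiableOn ℂ g {z | |z.im| ≤ d})
    (hgC : ∀ x y : ℝ, |y| ≤ d → ‖g (x + y * Complex.I)‖ ≤ C * (1 + x ^ 2)⁻¹)
    (hN : ∀ y : ℝ, |y| = d → ∫ x : ℝ, ‖g (x + y * Complex.I)‖ ≤ N) :
    ‖(∑' k : ℤ, g k) - ∫ x : ℝ, g x‖ ≤
      2 * N * (Real.exp (-(2 * Real.pi * d)) / (1 - Real.exp (-(2 * Real.pi * d)))) := by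
  set r := Real.exp (-(2 * Real.pi * d)) with hr
  have hr0 : 0 < r := Real.exp_pos _
  have hr1 : r < 1 := by
    rw [hr, Real.exp_lt_one_iff]
    have := mul_pos Real.two_pi_pos hd
    linarith
  set F : ℤ → ℂ := fun m => ∫ x : ℝ, Complex.exp (-(2 * Real.pi * m * x) * Complex.I) * g x with hF
  have hFour : ∀ m : ℤ, FourierTransform.fourier (fun x : ℝ => g x) (m : ℝ) = F m := by
    intro m
    rw [Real.fourier_real_eq_integral_exp_smul]
    refine integral_congr_ae (Eventually.of_forall fun x => ?_)
    simp only [smul_eq_mul]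
    congr 2
    push_cast
    ring
  have hpos : ∀ n : ℕ, ‖F ((n : ℤ) + 1)‖ ≤ N * r ^ (n + 1) := by
    intro n
    -- Positive frequencies decay when the line is moved down, negative ones when it is moved up.
    have := norm_fourier_line_le hg hgC (y := -d) (by rw [abs_neg, abs_of_pos hd])
      (hN _ (by rw [abs_neg, abs_of_pos hd])) ((n : ℝ) + 1)
    rw [hr, ← Real.exp_nat_mul]
    convert this using 2
    · simp [hF]
    · congr 1; push_cast; ring
  have hneg : ∀ n : ℕ, ‖F (-((n : ℤ) + 1))‖ ≤ N * r ^ (n + 1) := by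
    intro n
    have := norm_fourier_line_le hg hgC (y := d) (by rw [abs_of_pos hd])
      (hN _ (by rw [abs_of_pos hd])) (-((n : ℝ) + 1))
    rw [hr, ← Real.exp_nat_mul]
    convert this using 2
    · simp [hF]
    · congr 1; push_cast; ring
  have hgeo : HasSum (fun n : ℕ => N * r ^ (n + 1)) (N * (r / (1 - r))) := by
    have := ((hasSum_geometric_of_lt_one hr0.le hr1).mul_left r).mul_left N
    simpa [pow_succ', div_eq_mul_inv] using this
  have hs1 : Summable fun n : ℕ => F ((n : ℤ) + 1) := .of_norm_bounded hgeo.summable hpos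
  have hs2 : Summable fun n : ℕ => F (-((n : ℤ) + 1)) := .of_norm_bounded hgeo.summable hneg
  have hs0 : Summable fun n : ℕ => F n := by
    rw [← summable_nat_add_iff 1]
    simpa using hs1
  have hsF : Summable F := .of_nat_of_neg_add_one hs0 hs2
  have hcont : Continuous fun x : ℝ => g x := by
    simpa using continuous_line hg (y := 0) (by simpa using hd.le)
  have hdec : (fun x : ℝ => g x) =O[cocompact ℝ] fun x : ℝ => |x| ^ (-2 : ℝ) := by
    refine Asymptotics.IsBigO.of_bound |C| ?_
    filter_upwards [(isCompact_singleton (x := (0 : ℝ))).compl_mem_cocompact] with x hx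
    have hx0 : x ≠ 0 := hx
    have hx' : 0 < x ^ 2 := by positivity
    have := hgC x 0 (by simpa using hd.le)
    simp only [Complex.ofReal_zero, zero_mul, add_zero] at this
    rw [Real.rpow_neg (abs_nonneg _), Real.norm_of_nonneg (by positivity)]
    refine this.trans (mul_le_mul (le_abs_self _) ?_ (by positivity) (abs_nonneg _))
    refine inv_anti₀ (by positivity) ?_
    rw [Real.rpow_two, sq_abs]; linarith
  have hP := Real.tsum_eq_tsum_fourier_of_rpow_decay_of_summable hcont (b := 2) (by norm_num) hdec
    (by simpa only [hFour] using hsF) 0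
  simp only [hFour, zero_add, Complex.ofReal_intCast] at hP
  have hP' : ∑' k : ℤ, g k = ∑' m : ℤ, F m := by
    rw [hP]
    refine tsum_congr fun m => ?_
    rw [show ((0 : ℝ) : UnitAddCircle) = 0 from rfl, fourier_eval_zero, mul_one]
  have hF0 : F 0 = ∫ x : ℝ, g x := by simp [hF]
  rw [hP', tsum_of_nat_of_neg_add_one hs0 hs2, hs0.tsum_eq_zero_add, ← hF0]
  have e1 : ‖∑' n : ℕ, F ((n : ℤ) + 1)‖ ≤ N * (r / (1 - r)) := tsum_of_norm_bounded hgeo hpos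
  have e2 : ‖∑' n : ℕ, F (-((n : ℤ) + 1))‖ ≤ N * (r / (1 - r)) := tsum_of_norm_bounded hgeo hneg
  have e3 := norm_add_le (∑' n : ℕ, F ((n : ℤ) + 1)) (∑' n : ℕ, F (-((n : ℤ) + 1)))
  push_cast
  rw [show ∀ a b c : ℂ, a + b + c - a = b + c from fun a b c => by ring]
  linarith

lemma summable_int_of_le_inv_one_add_sq {F : Type*} [NormedAddCommGroup F] [CompleteSpace F]
    {f : ℤ → F} {C : ℝ}
    (h : ∀ k : ℤ, ‖f k‖ ≤ C * (1 + (k : ℝ) ^ 2)⁻¹) : Summable f := by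
  have : Summable fun k : ℤ => |C| * |(k : ℝ)| ^ (-2 : ℝ) :=
    (Real.summable_abs_int_rpow (by norm_num : (1 : ℝ) < 2)).mul_left _
  refine .of_norm_bounded_eventually this ?_
  filter_upwards [(Set.finite_singleton (0 : ℤ)).compl_mem_cofinite] with k hk
  have hk' : (k : ℝ) ≠ 0 := by exact_mod_cast hk
  have hx' : 0 < (k : ℝ) ^ 2 := by positivity
  rw [Real.rpow_neg (abs_nonneg _), Real.rpow_two, sq_abs]
  refine (h k).trans (mul_le_mul (le_abs_self _) ?_ (by positivity) (abs_nonneg _))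
  exact inv_anti₀ hx' (by linarith)

/-- The error of the trapezoidal rule for a function holomorphic in a strip of half width `d`. -/
lemma norm_tsum_sub_integral_le [CompleteSpace E] {g : ℂ → E} {d C N : ℝ} (hd : 0 < d)
    (hg : DifferentiableOn ℂ g {z | |z.im| ≤ d})
    (hgC : ∀ x y : ℝ, |y| ≤ d → ‖g (x + y * Complex.I)‖ ≤ C * (1 + x ^ 2)⁻¹)
    (hN : ∀ y : ℝ, |y| = d → ∫ x : ℝ, ‖g (x + y * Complex.I)‖ ≤ N) :
    ‖(∑' k : ℤ, g k) - ∫ x : ℝ, g x‖ ≤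
      2 * N * (Real.exp (-(2 * Real.pi * d)) / (1 - Real.exp (-(2 * Real.pi * d)))) := by
  -- A norming functional of the error reduces the Banach-valued case to the scalar one.
  obtain ⟨φ, hφ1, hφ⟩ := exists_dual_vector'' ℂ ((∑' k : ℤ, g k) - ∫ x : ℝ, g x)
  have hle : ∀ z, ‖φ z‖ ≤ ‖z‖ := fun z => by
    simpa using φ.le_of_opNorm_le hφ1 z
  have hd0 : |(0 : ℝ)| ≤ d := by simpa using hd.le
  have hsum : Summable fun k : ℤ => g k := by
    refine summable_int_of_le_inv_one_add_sq (C := C) fun k => ?_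
    simpa using hgC k 0 hd0
  have hint : Integrable fun x : ℝ => g x := by simpa using integrable_line hg hgC hd0
  have := norm_tsum_sub_integral_le_scalar (g := fun w => φ (g w)) (C := C) (N := N) hd
    (φ.differentiable.comp_differentiableOn hg) (fun x y hy => (hle _).trans (hgC x y hy))
    (fun y hy => le_trans ?_ (hN y hy))
  · rw [← φ.map_tsum hsum, φ.integral_comp_comm hint, ← map_sub, hφ] at this
    simpa using this
  · have hi := integrable_line hg hgC hy.le
    exact integral_mono (φ.integrable_comp hi).norm hi.norm fun x => hle _

end Trapezoid

/-! ### Integrals of `exp(-γ cosh x)` and the function `L`. -/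

lemma one_add_sq_div_two_le_cosh (x : ℝ) : 1 + x ^ 2 / 2 ≤ Real.cosh x := by
  have h1 : Real.cosh x = 1 + 2 * Real.sinh (x / 2) ^ 2 := by
    have := Real.cosh_two_mul (x / 2)
    rw [Real.cosh_sq, show 2 * (x / 2) = x by ring] at this
    linarith
  have h2 : (x / 2) ^ 2 ≤ Real.sinh (x / 2) ^ 2 := by
    rw [sq_le_sq, Real.abs_sinh]
    exact Real.self_le_sinh_iff.2 (abs_nonneg _)
  nlinarith

lemma cosh_add_ge {x y : ℝ} (hx : 0 ≤ x) (hy : 0 ≤ y) :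
    Real.cosh x + Real.cosh y - 1 ≤ Real.cosh (x + y) := by
  rw [Real.cosh_add]
  have := mul_nonneg (Real.sinh_nonneg_iff.2 hx) (Real.sinh_nonneg_iff.2 hy)
  nlinarith [Real.one_le_cosh x, Real.one_le_cosh y]

lemma exp_neg_lt_one {x : ℝ} (hx : 0 < x) : Real.exp (-x) < 1 := by
  rw [Real.exp_lt_one_iff]; linarith

lemma L_eq {x : ℝ} (hx : 0 < x) : L x = 1 - Real.log (1 - Real.exp (-x)) := by
  have h1 := exp_neg_lt_one hx
  have h2 := Real.exp_pos (-x)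
  rw [L, abs_of_nonpos (Real.log_nonpos (by linarith) (by linarith))]
  ring

lemma one_add_exp_neg_le_L {x : ℝ} (hx : 0 < x) : 1 + Real.exp (-x) ≤ L x := by
  have h1 := exp_neg_lt_one hx
  have := Real.log_le_sub_one_of_pos (x := 1 - Real.exp (-x)) (by linarith)
  rw [L_eq hx]
  linarith

lemma one_le_L (x : ℝ) : 1 ≤ L x := by
  rw [L]; linarith [abs_nonneg (Real.log (1 - Real.exp (-x)))]

lemma L_le_L {x y : ℝ} (hx : 0 < x) (hxy : x ≤ y) : L y ≤ L x := by
  have h1 := exp_neg_lt_one hx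
  rw [L_eq hx, L_eq (hx.trans_le hxy)]
  have : Real.exp (-y) ≤ Real.exp (-x) := Real.exp_le_exp.2 (by linarith)
  have := Real.log_le_log (x := 1 - Real.exp (-x)) (y := 1 - Real.exp (-y)) (by linarith)
    (by linarith)
  linarith

/-- With `v = γ e^y`, the function `log(1 - e^{-v})` has `y`-derivative `v e^{-v} / (1 - e^{-v})`,
which dominates `e^{-v}` because `1 - e^{-v} ≤ v`. This is where the logarithm in `L` comes from. -/
lemma integral_exp_neg_mul_exp_le {γ b : ℝ} (hγ : 0 < γ) (hb : 0 ≤ b) :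
    ∫ y in (0 : ℝ)..b, Real.exp (-(γ * Real.exp y)) ≤ L γ - 1 := by
  set F : ℝ → ℝ := fun y => Real.log (1 - Real.exp (-(γ * Real.exp y))) with hF
  set F' : ℝ → ℝ := fun y => γ * Real.exp y * Real.exp (-(γ * Real.exp y)) /
    (1 - Real.exp (-(γ * Real.exp y))) with hF'
  have hpos : ∀ y : ℝ, 0 < 1 - Real.exp (-(γ * Real.exp y)) := fun y => by
    have := exp_neg_lt_one (mul_pos hγ (Real.exp_pos y)); linarith
  have hder : ∀ y, HasDerivAt F (F' y) y := by
    intro y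
    have h1 : HasDerivAt (fun y => Real.exp (-(γ * Real.exp y)))
        (Real.exp (-(γ * Real.exp y)) * (-(γ * Real.exp y))) y :=
      (((Real.hasDerivAt_exp y).const_mul γ).neg).exp
    have := (h1.const_sub 1).log (hpos y).ne'
    convert this using 1
    rw [hF']; simp only; ring
  have hcont : Continuous F' := by
    rw [hF']
    exact Continuous.div (by fun_prop) (by fun_prop) fun y => (hpos y).ne'
  have hint := intervalIntegral.integral_eq_sub_of_hasDerivAt (a := 0) (b := b)
    (fun y _ => hder y) (hcont.intervalIntegrable _ _)
  have hle : ∫ y in (0 : ℝ)..b, Real.exp (-(γ * Real.exp y)) ≤ ∫ y in (0 : ℝ)..b, F' y := by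
    refine intervalIntegral.integral_mono_on hb (Continuous.intervalIntegrable (by fun_prop) _ _)
      (hcont.intervalIntegrable _ _) fun y _ => ?_
    rw [hF']
    simp only
    rw [le_div_iff₀ (hpos y), mul_comm]
    refine mul_le_mul_of_nonneg_right ?_ (Real.exp_pos _).le
    have := Real.add_one_le_exp (-(γ * Real.exp y))
    linarith
  have hFb : F b ≤ 0 := Real.log_nonpos (hpos b).le (by
    have := Real.exp_pos (-(γ * Real.exp b)); linarith)
  have hF0 : F 0 = Real.log (1 - Real.exp (-γ)) := by simp [hF]
  rw [L_eq hγ]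
  linarith

/-- On `[0, a]` the integrand is at most `1`; beyond `a`, the shift by `a` compares `cosh - s` with
the exponential. It is applied with `(a, s) = (1, 0)` and `(2, 1)`. -/
lemma integral_exp_neg_mul_cosh_sub_le {γ a s b : ℝ} (hγ : 0 < γ) (ha : 0 ≤ a) (hs : s ≤ 1)
    (h : ∀ y, 0 ≤ y → Real.exp y + s ≤ Real.cosh (y + a)) (hb : 0 ≤ b) :
    ∫ x in (0 : ℝ)..b, Real.exp (-(γ * (Real.cosh x - s))) ≤ a + (L γ - 1) := by
  have hc : Continuous fun x : ℝ => Real.exp (-(γ * (Real.cosh x - s))) := by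
    have := Real.continuous_cosh
    fun_prop
  have h1 : ∫ x in (0 : ℝ)..b, Real.exp (-(γ * (Real.cosh x - s))) ≤
      ∫ x in (0 : ℝ)..(b + a), Real.exp (-(γ * (Real.cosh x - s))) :=
    intervalIntegral.integral_mono_interval le_rfl hb (by linarith)
      (Eventually.of_forall fun x => (Real.exp_pos _).le) (hc.intervalIntegrable _ _)
  have h2 : ∫ x in (0 : ℝ)..a, Real.exp (-(γ * (Real.cosh x - s))) ≤ a := by
    have : ∫ x in (0 : ℝ)..a, Real.exp (-(γ * (Real.cosh x - s))) ≤ ∫ x in (0 : ℝ)..a, (1 : ℝ) := by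
      refine intervalIntegral.integral_mono_on ha (hc.intervalIntegrable _ _)
        intervalIntegrable_const fun x _ => ?_
      rw [Real.exp_le_one_iff]
      have := mul_nonneg hγ.le (show 0 ≤ Real.cosh x - s by linarith [Real.one_le_cosh x])
      linarith
    simpa using this
  have h3 : ∫ x in a..(b + a), Real.exp (-(γ * (Real.cosh x - s))) ≤ L γ - 1 := by
    have e := intervalIntegral.integral_comp_add_right (a := 0) (b := b)
      (fun x => Real.exp (-(γ * (Real.cosh x - s)))) a
    rw [zero_add] at e
    rw [← e]
    refine le_trans ?_ (integral_exp_neg_mul_exp_le hγ hb)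
    refine intervalIntegral.integral_mono_on hb (Continuous.intervalIntegrable (by fun_prop) _ _)
      (Continuous.intervalIntegrable (by fun_prop) _ _) fun y hy => ?_
    refine Real.exp_le_exp.2 (neg_le_neg (mul_le_mul_of_nonneg_left ?_ hγ.le))
    linarith [h y hy.1]
  have h4 := intervalIntegral.integral_add_adjacent_intervals
    (hc.intervalIntegrable (μ := volume) 0 a) (hc.intervalIntegrable a (b + a))
  linarith

lemma exp_le_cosh_add_one (y : ℝ) : Real.exp y + 0 ≤ Real.cosh (y + 1) := by
  have h1 := Real.exp_one_gt_d9
  have h2 := Real.exp_pos y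
  have h3 := Real.exp_pos (-(y + 1))
  rw [Real.cosh_eq, Real.exp_add]
  nlinarith

lemma exp_add_one_le_cosh_add_two {y : ℝ} (hy : 0 ≤ y) :
    Real.exp y + 1 ≤ Real.cosh (y + 2) := by
  have h1 := Real.exp_one_gt_d9
  have h2 := Real.one_le_exp hy
  have h3 := Real.exp_pos (-(y + 2))
  have h4 : Real.exp 2 = Real.exp 1 * Real.exp 1 := by rw [← Real.exp_add]; norm_num
  have h5 : 4 ≤ Real.exp 2 := by rw [h4]; nlinarith
  rw [Real.cosh_eq, Real.exp_add]
  nlinarith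

lemma integral_exp_neg_mul_cosh_le {γ b : ℝ} (hγ : 0 < γ) (hb : 0 ≤ b) :
    ∫ x in (0 : ℝ)..b, Real.exp (-(γ * Real.cosh x)) ≤ L γ := by
  have := integral_exp_neg_mul_cosh_sub_le hγ zero_le_one zero_le_one
    (fun y _ => exp_le_cosh_add_one y) hb
  simpa using this

lemma integral_exp_neg_mul_cosh_sub_one_le {γ b : ℝ} (hγ : 0 < γ) (hb : 0 ≤ b) :
    ∫ x in (0 : ℝ)..b, Real.exp (-(γ * (Real.cosh x - 1))) ≤ 2 * L γ := by
  have := integral_exp_neg_mul_cosh_sub_le hγ zero_le_two le_rfl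
    (fun y hy => exp_add_one_le_cosh_add_two hy) hb
  linarith [one_le_L γ]

lemma exp_neg_mul_cosh_le {γ : ℝ} (hγ : 0 < γ) (x : ℝ) :
    Real.exp (-(γ * Real.cosh x)) ≤ 2 / γ * (1 + x ^ 2)⁻¹ := by
  have h1 := Real.add_one_le_exp (γ * Real.cosh x)
  have h2 := one_add_sq_div_two_le_cosh x
  rw [Real.exp_neg, div_mul_eq_mul_div, ← div_eq_mul_inv, div_div,
    inv_eq_one_div, div_le_div_iff₀ (Real.exp_pos _) (by positivity)]
  nlinarith [mul_le_mul_of_nonneg_left h2 hγ.le, sq_nonneg x, mul_nonneg hγ.le (sq_nonneg x)]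

lemma integrable_exp_neg_mul_cosh {γ : ℝ} (hγ : 0 < γ) :
    Integrable fun x : ℝ => Real.exp (-(γ * Real.cosh x)) := by
  have hc := Real.continuous_cosh
  refine (integrable_inv_one_add_sq.const_mul (2 / γ)).mono'
    (Continuous.aestronglyMeasurable (by fun_prop)) (Eventually.of_forall fun x => ?_)
  rw [Real.norm_of_nonneg (Real.exp_pos _).le]
  exact exp_neg_mul_cosh_le hγ x

lemma integral_line_exp_neg_mul_cosh_le {γ : ℝ} (hγ : 0 < γ) :
    ∫ x : ℝ, Real.exp (-(γ * Real.cosh x)) ≤ 2 * L γ := by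
  have h := intervalIntegral_tendsto_integral (integrable_exp_neg_mul_cosh hγ)
    tendsto_neg_atTop_atBot tendsto_id
  refine le_of_tendsto h ?_
  filter_upwards [eventually_ge_atTop 0] with R hR
  have hi : ∀ a b, IntervalIntegrable (fun x : ℝ => Real.exp (-(γ * Real.cosh x))) volume a b :=
    fun a b => (integrable_exp_neg_mul_cosh hγ).intervalIntegrable
  have h1 := intervalIntegral.integral_add_adjacent_intervals (hi (-R) 0) (hi 0 R)
  have h2 := intervalIntegral.integral_comp_neg (a := 0) (b := R)
    (fun x : ℝ => Real.exp (-(γ * Real.cosh x)))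
  simp only [Real.cosh_neg, neg_zero] at h2
  have h3 := integral_exp_neg_mul_cosh_le hγ hR
  simp only [id]
  linarith

/-! ### Sums over the nodes compared with integrals, and truncation. -/

lemma mul_sum_le_integral {f : ℝ → ℝ} {h : ℝ} (hh : 0 < h) (hf : AntitoneOn f (Ici 0)) (n : ℕ) :
    h * ∑ j ∈ Finset.range n, f ((j + 1) * h) ≤ ∫ x in (0 : ℝ)..(n * h), f x := by
  have h1 := AntitoneOn.sum_le_integral (f := fun x => f (x * h)) (x₀ := 0) (a := n)
    (fun x hx y hy hxy => hf (mul_nonneg hx.1 hh.le) (mul_nonneg hy.1 hh.le)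
      (mul_le_mul_of_nonneg_right hxy hh.le))
  rw [intervalIntegral.integral_comp_mul_right _ hh.ne'] at h1
  simp only [zero_add, zero_mul, smul_eq_mul] at h1
  rw [inv_mul_eq_div, le_div_iff₀' hh] at h1
  push_cast at h1
  exact h1

lemma antitoneOn_exp_neg_mul_cosh_sub {γ : ℝ} (hγ : 0 < γ) (s : ℝ) :
    AntitoneOn (fun x => Real.exp (-(γ * (Real.cosh x - s)))) (Ici 0) := by
  intro x hx y hy hxy
  refine Real.exp_le_exp.2 (neg_le_neg (mul_le_mul_of_nonneg_left (sub_le_sub_right ?_ _) hγ.le))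
  rw [Real.cosh_le_cosh, abs_of_nonneg hx, abs_of_nonneg hy]
  exact hxy

lemma mul_sum_exp_neg_mul_cosh_le {γ h : ℝ} (hγ : 0 < γ) (hh : 0 < h) (n : ℕ) :
    h * ∑ j ∈ Finset.range n, Real.exp (-(γ * Real.cosh ((j + 1) * h))) ≤ L γ := by
  have h1 := mul_sum_le_integral hh (antitoneOn_exp_neg_mul_cosh_sub hγ 0) n
  simp only [sub_zero] at h1
  exact h1.trans (integral_exp_neg_mul_cosh_le hγ (by positivity))

/-- By `cosh(x + y) ≥ (cosh x - 1) + cosh y` with `y = nh`, the factor `exp(-γ cosh(nh))` splits off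
and leaves a sum starting afresh at `h`. -/
lemma mul_sum_exp_neg_mul_cosh_tail_le {γ h : ℝ} (hγ : 0 < γ) (hh : 0 < h) (n N : ℕ) :
    h * ∑ j ∈ Finset.range N, Real.exp (-(γ * Real.cosh ((j + n + 1) * h))) ≤
      2 * L γ * Real.exp (-(γ * Real.cosh (n * h))) := by
  have h1 := (mul_sum_le_integral hh (antitoneOn_exp_neg_mul_cosh_sub hγ 1) N).trans
    (integral_exp_neg_mul_cosh_sub_one_le hγ (by positivity))
  refine le_trans ?_ (mul_le_mul_of_nonneg_right h1 (Real.exp_pos _).le)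
  rw [mul_assoc, Finset.sum_mul]
  refine mul_le_mul_of_nonneg_left (Finset.sum_le_sum fun j _ => ?_) hh.le
  rw [← Real.exp_add, Real.exp_le_exp]
  have := cosh_add_ge (x := (j + 1) * h) (y := n * h) (by positivity) (by positivity)
  rw [show (j + 1) * h + n * h = (j + n + 1) * h by ring] at this
  nlinarith

lemma sum_Icc_neg_eq {F : Type*} [AddCommMonoid F] (f : ℤ → F) (n : ℕ) :
    ∑ k ∈ Finset.Icc (-(n : ℤ)) n, f k =
      f 0 + ∑ j ∈ Finset.range n, (f (j + 1) + f (-(j + 1))) := by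
  induction n with
  | zero => simp
  | succ n ih =>
    have : Finset.Icc (-((n + 1 : ℕ) : ℤ)) (n + 1 : ℕ) =
        insert ((n : ℤ) + 1) (insert (-((n : ℤ) + 1)) (Finset.Icc (-(n : ℤ)) n)) := by
      ext k
      simp only [Finset.mem_Icc, Finset.mem_insert]
      push_cast
      omega
    rw [this, Finset.sum_insert (by simp; omega), Finset.sum_insert (by simp), ih,
      Finset.sum_range_succ]
    abel

lemma norm_tsum_sub_sum_Icc_le {F : Type*} [NormedAddCommGroup F] [CompleteSpace F]
    {f : ℤ → F} (hf : Summable f) (n : ℕ) {B : ℝ}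
    (h1 : ∀ N : ℕ, ∑ j ∈ Finset.range N, ‖f (j + n + 1)‖ ≤ B)
    (h2 : ∀ N : ℕ, ∑ j ∈ Finset.range N, ‖f (-(j + n + 1))‖ ≤ B) :
    ‖(∑' k, f k) - ∑ k ∈ Finset.Icc (-(n : ℤ)) n, f k‖ ≤ 2 * B := by
  have hp : Summable fun j : ℕ => f j := hf.comp_injective Nat.cast_injective
  have hn : Summable fun j : ℕ => f (-((j : ℤ) + 1)) :=
    hf.comp_injective fun a b hab => by simpa using hab
  have key : ∀ g : ℕ → F, Summable g → (∀ N : ℕ, ∑ j ∈ Finset.range N, ‖g j‖ ≤ B) →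
      ‖∑' j, g j‖ ≤ B := fun g hg hB =>
    le_of_tendsto hg.hasSum.tendsto_sum_nat.norm
      (Eventually.of_forall fun N => (norm_sum_le _ _).trans (hB N))
  have e1 := hp.sum_add_tsum_nat_add (n + 1)
  have e2 := hn.sum_add_tsum_nat_add n
  have k1 := key (fun j => f ((j + (n + 1) : ℕ))) ((summable_nat_add_iff (n + 1)).2 hp) (fun N => by
    simpa [add_assoc] using h1 N)
  have k2 := key (fun j => f (-(((j + n : ℕ) : ℤ) + 1))) ((summable_nat_add_iff n).2 hn) (fun N => by
    simpa using h2 N)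
  rw [tsum_of_nat_of_neg_add_one hp hn, ← e1, ← e2, sum_Icc_neg_eq, Finset.sum_range_succ',
    Finset.sum_add_distrib]
  have e3 := norm_add_le (∑' j : ℕ, f ((j + (n + 1) : ℕ))) (∑' j : ℕ, f (-(((j + n : ℕ) : ℤ) + 1)))
  refine le_trans (le_of_eq ?_) (e3.trans (by linarith))
  congr 1
  push_cast
  abel

/-! ### Amplification of absolute errors. -/

lemma cosh_sinh_taylor {x : ℝ} (h0 : 0 ≤ x) (h1 : x ≤ 1) :
    Real.cosh x ≤ 1 + x ^ 2 / 2 + x ^ 4 / 18 ∧ x + x ^ 3 / 6 ≤ Real.sinh x := by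
  have e1 := Real.exp_bound (x := x) (by rwa [abs_of_nonneg h0]) (n := 6) (by norm_num)
  have e2 := Real.exp_bound (x := -x) (by rwa [abs_neg, abs_of_nonneg h0]) (n := 6) (by norm_num)
  rw [abs_neg] at e2
  rw [abs_of_nonneg h0, abs_le] at e1 e2
  simp only [Finset.sum_range_succ, Finset.sum_range_zero, Nat.factorial] at e1 e2
  norm_num at e1 e2
  have p4 : 0 ≤ x ^ 4 := by positivity
  have p6 : x ^ 6 ≤ x ^ 4 := pow_le_pow_of_le_one h0 h1 (by norm_num)
  have p65 : x ^ 6 ≤ x ^ 5 := pow_le_pow_of_le_one h0 h1 (by norm_num)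
  rw [Real.cosh_eq, Real.sinh_eq]
  constructor
  · linarith [e1.1, e1.2, e2.1, e2.2]
  · linarith [e1.1, e1.2, e2.1, e2.2]

/-- The coefficient `1/18` in the bound for `cosh` makes `x (1 + x²/2 + x⁴/18)` factor exactly as
`(1 + x²/3)(x + x³/6)`. -/
lemma mul_cosh_le {x : ℝ} (h0 : 0 ≤ x) (h1 : x ≤ 1) :
    x * Real.cosh x ≤ (1 + x ^ 2 / 3) * Real.sinh x := by
  obtain ⟨hc, hs⟩ := cosh_sinh_taylor h0 h1
  calc x * Real.cosh x ≤ x * (1 + x ^ 2 / 2 + x ^ 4 / 18) := by gcongr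
    _ = (1 + x ^ 2 / 3) * (x + x ^ 3 / 6) := by ring
    _ ≤ _ := by gcongr

lemma mul_cosh_le_sinh {x : ℝ} (h0 : 0 ≤ x) (h1 : x ≤ 4 / 5) :
    4 / 5 * x * Real.cosh x ≤ Real.sinh x := by
  obtain ⟨hc, hs⟩ := cosh_sinh_taylor h0 (by linarith)
  have hx2 : x ^ 2 ≤ 16 / 25 := by nlinarith
  calc 4 / 5 * x * Real.cosh x ≤ 4 / 5 * x * (1 + x ^ 2 / 2 + x ^ 4 / 18) := by gcongr
    _ ≤ x + x ^ 3 / 6 := by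
      have : 0 ≤ x * (1 / 5 - 7 / 30 * x ^ 2 - 2 / 45 * (x ^ 2 * x ^ 2)) := by
        refine mul_nonneg h0 ?_
        nlinarith [sq_nonneg x]
      linarith
    _ ≤ _ := hs

lemma mul_exp_le_exp_sub_exp (κ A D : ℝ) (hD : 0 ≤ κ * D) :
    2 * (κ * D) * Real.exp (-(κ * A)) ≤ Real.exp (-(κ * (A - D))) - Real.exp (-(κ * (A + D))) := by
  have h1 := Real.self_le_sinh_iff.2 hD
  rw [Real.sinh_eq] at h1
  rw [show -(κ * (A - D)) = κ * D + -(κ * A) by ring,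
    show -(κ * (A + D)) = -(κ * D) + -(κ * A) by ring, Real.exp_add, Real.exp_add, ← sub_mul]
  exact mul_le_mul_of_nonneg_right (by linarith) (Real.exp_pos _).le

/-- Each term is at most the difference of `exp(-κ sinh)` at the two half-nodes `x ∓ h/2`, by the
addition formulas and `2D ≤ e^D - e^{-D}`; the differences telescope. -/
lemma sum_cosh_mul_exp_neg_sinh_le {κ h : ℝ} (hκ : 0 < κ) (hh : 0 < h) (n : ℕ) :
    ∑ j ∈ Finset.range n, 2 * (κ * Real.sinh (h / 2)) * (Real.cosh ((j + 1) * h) *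
      Real.exp (-(κ * Real.cosh (h / 2) * Real.sinh ((j + 1) * h)))) ≤
      Real.exp (-(κ * Real.sinh (h / 2))) := by
  have hs : 0 ≤ Real.sinh (h / 2) := Real.sinh_nonneg_iff.2 (by linarith)
  suffices H : ∑ j ∈ Finset.range n, 2 * (κ * Real.sinh (h / 2)) * (Real.cosh ((j + 1) * h) *
      Real.exp (-(κ * Real.cosh (h / 2) * Real.sinh ((j + 1) * h)))) ≤
      Real.exp (-(κ * Real.sinh (h / 2))) - Real.exp (-(κ * Real.sinh (n * h + h / 2))) by
    linarith [Real.exp_pos (-(κ * Real.sinh (n * h + h / 2)))]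
  induction n with
  | zero => simp
  | succ n ih =>
    rw [Finset.sum_range_succ]
    have := mul_exp_le_exp_sub_exp κ (Real.sinh ((n + 1) * h) * Real.cosh (h / 2))
      (Real.cosh ((n + 1) * h) * Real.sinh (h / 2))
      (mul_nonneg hκ.le (mul_nonneg (Real.cosh_pos _).le hs))
    rw [← Real.sinh_sub, ← Real.sinh_add,
      show (n + 1) * h - h / 2 = n * h + h / 2 by ring] at this
    push_cast
    refine (add_le_add ih (le_trans (le_of_eq ?_) this)).trans (by linarith)
    rw [show κ * Real.cosh (h / 2) * Real.sinh ((n + 1) * h) =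
      κ * (Real.sinh ((n + 1) * h) * Real.cosh (h / 2)) by ring]
    ring

/-- The right side is `√(1 + s²)` with `s = sinh x`, and the left side is its tangent at `s = 12/5`.
It trades `cosh` in the exponent for `sinh`, for which the sum telescopes. -/
lemma add_mul_sinh_le_cosh (x : ℝ) : 5 / 13 + 12 / 13 * Real.sinh x ≤ Real.cosh x := by
  have := Real.cosh_sq x
  refine le_of_sq_le_sq ?_ (Real.cosh_pos x).le
  nlinarith [sq_nonneg (5 * Real.sinh x - 12)]

/-- Both sides are affine in `Y`, so the cases `Y = 0` (`p0`) and `Y = 1` (`p1`) suffice. -/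
lemma linear_interpolation_le {h Y : ℝ} (hh : 0 ≤ h) (hh' : h ≤ 8 / 5) (hY0 : 0 ≤ Y)
    (hY1 : Y ≤ 1) :
    h * (0.6066 - Y / 2) + 13 / 6 * (1 + h ^ 2 / 12) *
      ((1 - (5 / 13 + 12 / 13 * (2 / 5 * h))) + (5 / 13 + 12 / 13 * (2 / 5 * h)) * Y) ≤
      1.4715 * (1 + Y) := by
  set r := 5 / 13 + 12 / 13 * (2 / 5 * h) with hr
  have p0 : h * 0.6066 + 13 / 6 * (1 + h ^ 2 / 12) * (1 - r) ≤ 1.4715 := by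
    have e : h * 0.6066 + 13 / 6 * (1 + h ^ 2 / 12) * (1 - r) =
        4 / 3 - h * (0.1934 - h / 9) - h ^ 3 / 15 := by rw [hr]; ring
    rw [e]
    have q1 : 0 ≤ h * (0.1934 - h / 9) := mul_nonneg hh (by norm_num; linarith)
    have q2 : 0 ≤ h ^ 3 := by positivity
    norm_num at q1 ⊢
    linarith
  have p1 : h * 0.1066 + 13 / 6 * (1 + h ^ 2 / 12) ≤ 2.943 := by
    have : h ^ 2 ≤ 64 / 25 := by nlinarith
    norm_num
    linarith
  have e : h * (0.6066 - Y / 2) + 13 / 6 * (1 + h ^ 2 / 12) * ((1 - r) + r * Y) =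
      (1 - Y) * (h * 0.6066 + 13 / 6 * (1 + h ^ 2 / 12) * (1 - r)) +
      Y * (h * 0.1066 + 13 / 6 * (1 + h ^ 2 / 12)) := by norm_num; ring
  have q0 := mul_le_mul_of_nonneg_left p0 (show 0 ≤ 1 - Y by linarith)
  have q1 := mul_le_mul_of_nonneg_left p1 hY0
  rw [e]
  norm_num at q0 q1 ⊢
  linarith

/-- For step sizes up to `8 / 5` the sum is controlled by telescoping. -/
lemma mul_sum_mul_cosh_mul_exp_le {γ h : ℝ} (hγ : 0 < γ) (hh : 0 < h) (hh' : h ≤ 8 / 5) (n : ℕ) :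
    h * ∑ k ∈ Finset.Icc (-(n : ℤ)) n, γ * Real.cosh (k * h) * Real.exp (-(γ * Real.cosh (k * h))) ≤
      4 / Real.exp 1 * L γ := by
  set S := Real.sinh (h / 2) with hS
  set C := Real.cosh (h / 2) with hC
  have hSpos : 0 < S := Real.sinh_pos_iff.2 (by linarith)
  have hCpos : 0 < C := Real.cosh_pos _
  set τ := S / C with hτ
  have hτpos : 0 < τ := div_pos hSpos hCpos
  have hτ1 : 2 / 5 * h ≤ τ := by
    rw [hτ, le_div_iff₀ hCpos]
    have := mul_cosh_le_sinh (x := h / 2) (by linarith) (by linarith)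
    linarith
  have hτ2 : h ≤ 2 * (1 + h ^ 2 / 12) * τ := by
    rw [hτ, mul_div_assoc', le_div_iff₀ hCpos]
    have := mul_cosh_le (x := h / 2) (by linarith) (by linarith)
    nlinarith
  -- Chosen so that `κ cosh(h/2)` is the slope `12γ/13` of the tangent bound; `κ sinh(h/2)` is then
  -- `12γτ/13` with `τ = tanh(h/2)`.
  set κ := γ * (12 / 13) / C with hκ
  have hκpos : 0 < κ := by positivity
  have hκC : κ * C = 12 / 13 * γ := by rw [hκ]; field_simp
  have hκS : κ * S = 12 / 13 * γ * τ := by rw [hκ, hτ]; field_simp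
  have hsum := sum_cosh_mul_exp_neg_sinh_le hκpos hh n
  rw [← hS, ← hC, hκC, hκS, ← Finset.mul_sum] at hsum
  set B := ∑ j ∈ Finset.range n, γ * Real.cosh ((j + 1) * h) *
    Real.exp (-(γ * Real.cosh ((j + 1) * h))) with hB
  set r := 5 / 13 + 12 / 13 * (2 / 5 * h) with hr
  have hhB : h * B ≤ 13 / 12 * (1 + h ^ 2 / 12) * Real.exp (-(γ * r)) := by
    have h1 : B ≤ γ * Real.exp (-(5 / 13 * γ)) * ∑ j ∈ Finset.range n, Real.cosh ((j + 1) * h) *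
        Real.exp (-(12 / 13 * γ * Real.sinh ((j + 1) * h))) := by
      rw [hB, Finset.mul_sum]
      refine Finset.sum_le_sum fun j _ => ?_
      have : Real.exp (-(γ * Real.cosh ((j + 1) * h))) ≤ Real.exp (-(5 / 13 * γ)) *
          Real.exp (-(12 / 13 * γ * Real.sinh ((j + 1) * h))) := by
        rw [← Real.exp_add, Real.exp_le_exp]
        nlinarith [add_mul_sinh_le_cosh ((j + 1) * h)]
      have hc := mul_pos hγ (Real.cosh_pos ((j + 1) * h))
      nlinarith
    have hS0 : 0 ≤ B := by positivity
    have h2 : 2 * τ * B ≤ 13 / 12 * Real.exp (-(γ * r)) := by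
      have e1 : Real.exp (-(5 / 13 * γ)) * Real.exp (-(12 / 13 * γ * τ)) ≤
          Real.exp (-(γ * r)) := by
        rw [← Real.exp_add, Real.exp_le_exp, hr]
        nlinarith
      have e2 := mul_le_mul_of_nonneg_left hsum (Real.exp_pos (-(5 / 13 * γ))).le
      nlinarith
    calc h * B ≤ 2 * (1 + h ^ 2 / 12) * τ * B := by gcongr
      _ = (1 + h ^ 2 / 12) * (2 * τ * B) := by ring
      _ ≤ (1 + h ^ 2 / 12) * (13 / 12 * Real.exp (-(γ * r))) := by gcongr
      _ = _ := by ring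
  have hfull : ∑ k ∈ Finset.Icc (-(n : ℤ)) n, γ * Real.cosh (k * h) *
      Real.exp (-(γ * Real.cosh (k * h))) = γ * Real.exp (-γ) + 2 * B := by
    rw [sum_Icc_neg_eq, hB, Finset.mul_sum]
    congr 1
    · simp
    · refine Finset.sum_congr rfl fun j _ => ?_
      push_cast
      rw [neg_mul, Real.cosh_neg]
      ring
  rw [hfull]
  set Y := Real.exp (-γ) with hY
  have hY0 : 0 < Y := Real.exp_pos _
  have hY1 : Y < 1 := exp_neg_lt_one hγ
  -- Convexity of `exp` between `0` and `-γ`. The bound `h ≤ 8/5` ensures `r ≤ 1`.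
  have hYr : Real.exp (-(γ * r)) ≤ (1 - r) + r * Y := by
    have := convexOn_exp.2 (mem_univ (0 : ℝ)) (mem_univ (-γ))
      (show 0 ≤ 1 - r by rw [hr]; linarith) (show 0 ≤ r by rw [hr]; linarith) (by ring)
    simp only [smul_eq_mul, mul_zero, zero_add, Real.exp_zero, mul_one] at this
    rwa [show -(γ * r) = r * -γ by ring]
  -- From `γ + 1/2 ≤ e^{γ - 1/2}` one gets `(γ + 1/2) e^{-γ} ≤ e^{-1/2}`, so the central term too is
  -- bounded by an affine function of `Y`.
  have hγY : γ * Y ≤ 0.6066 - Y / 2 := by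
    have h1 := Real.add_one_le_exp (γ - 1 / 2)
    have h2 : Real.exp (γ - 1 / 2) * Y = Real.exp (-(1 / 2)) := by
      rw [hY, ← Real.exp_add]; congr 1; ring
    have h3 : Real.exp (-(1 / 2)) ≤ 0.6066 := by
      have e1 : Real.exp (-(1 / 2)) ^ 2 = (Real.exp 1)⁻¹ := by
        rw [← Real.exp_nat_mul, ← Real.exp_neg]; norm_num
      refine le_of_sq_le_sq ?_ (by norm_num)
      rw [e1]
      refine inv_le_of_inv_le₀ (by norm_num) ?_
      have := Real.exp_one_gt_d9
      norm_num at this ⊢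
      linarith
    nlinarith
  have he : 1.4715 ≤ 4 / Real.exp 1 := by
    rw [le_div_iff₀ (Real.exp_pos _)]
    have := Real.exp_one_lt_d9
    norm_num at this ⊢
    linarith
  have hL := one_add_exp_neg_le_L hγ
  have h2 : 4 / Real.exp 1 * L γ ≥ 1.4715 * (1 + Y) := by
    have : (0 : ℝ) ≤ 1.4715 := by norm_num
    refine mul_le_mul he hL (by linarith) (by positivity)
  have h3 : h * (2 * B) ≤ 13 / 6 * (1 + h ^ 2 / 12) * ((1 - r) + r * Y) := by
    have : 13 / 12 * (1 + h ^ 2 / 12) * Real.exp (-(γ * r)) ≤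
      13 / 12 * (1 + h ^ 2 / 12) * ((1 - r) + r * Y) := by gcongr
    linarith
  have h4 : h * (γ * Y) ≤ h * (0.6066 - Y / 2) := by gcongr
  have h5 := linear_interpolation_le hh.le hh' hY0.le hY1.le
  rw [← hr] at h5
  refine le_trans ?_ h2
  rw [mul_add]
  linarith

lemma exp_ge_of_ge {h : ℝ} (hh : 8 / 5 ≤ h) : 4.93 ≤ Real.exp h := by
  refine le_trans ?_ (Real.exp_le_exp.2 hh)
  -- The fifth power turns `e^{8/5}` into `e^8`, a power of the number `e`.
  refine le_of_pow_le_pow_left₀ (n := 5) (by norm_num) (Real.exp_pos _).le ?_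
  rw [← Real.exp_nat_mul, show ((5 : ℕ) : ℝ) * (8 / 5) = ((8 : ℕ) : ℝ) * 1 by norm_num,
    Real.exp_nat_mul]
  have := Real.exp_one_gt_d9
  refine le_trans ?_ (pow_le_pow_left₀ (by norm_num) this.le 8)
  norm_num

/-- The hyperbolic form of the Dirichlet kernel. -/
lemma sum_cosh_mul_sinh (h : ℝ) (n : ℕ) :
    (∑ k ∈ Finset.Icc (-(n : ℤ)) n, Real.cosh (k * h)) * Real.sinh (h / 2) =
      Real.sinh (n * h + h / 2) := by
  rw [sum_Icc_neg_eq]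
  induction n with
  | zero => simp
  | succ n ih =>
    rw [Finset.sum_range_succ, ← add_assoc, add_mul, ih]
    push_cast
    rw [neg_mul, Real.cosh_neg, show (n + 1) * h + h / 2 = (n * h + h / 2) + h by ring,
      show (n + 1) * h = (n * h + h / 2) + h / 2 by ring, Real.sinh_add _ h, Real.cosh_add _ (h / 2)]
    have h1 := Real.sinh_two_mul (h / 2)
    have h2 := Real.cosh_two_mul (h / 2)
    rw [show 2 * (h / 2) = h by ring] at h1 h2
    rw [h1, h2]
    linear_combination (-Real.sinh (n * h + h / 2)) * Real.cosh_sq (h / 2)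

lemma sum_cosh_le {h : ℝ} (hh : 8 / 5 ≤ h) (n : ℕ) :
    ∑ k ∈ Finset.Icc (-(n : ℤ)) n, Real.cosh (k * h) ≤ 2.51 * Real.cosh (n * h) := by
  have hS : 0 < Real.sinh (h / 2) := Real.sinh_pos_iff.2 (by linarith)
  refine le_of_mul_le_mul_right ?_ hS
  rw [sum_cosh_mul_sinh, Real.sinh_add]
  have h1 := (Real.sinh_lt_cosh (n * h)).le
  have h2 := Real.cosh_pos (n * h)
  have h3 : Real.cosh (h / 2) + Real.sinh (h / 2) ≤ 2.51 * Real.sinh (h / 2) := by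
    have e := exp_ge_of_ge hh
    rw [show h = h / 2 + h / 2 by ring, Real.exp_add] at e
    have e2 : Real.exp (h / 2) * Real.exp (-(h / 2)) = 1 := by
      rw [← Real.exp_add]; simp
    have e3 := Real.exp_pos (-(h / 2))
    rw [Real.cosh_add_sinh, Real.sinh_eq]
    have e4 := mul_le_mul_of_nonneg_right e e3.le
    rw [mul_assoc, e2, mul_one] at e4
    norm_num at e4 ⊢
    linarith
  have h4 := mul_le_mul_of_nonneg_right h1 (Real.cosh_pos (h / 2)).le
  have h5 := mul_le_mul_of_nonneg_left h3 h2.le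
  linarith

lemma one_add_add_le_sqrt {s : ℝ} (h0 : 0 ≤ s) (h1 : s < 1) :
    1 + s + s ^ 2 / 2 ≤ √((1 + s) / (1 - s)) := by
  refine Real.le_sqrt_of_sq_le ?_
  rw [le_div_iff₀ (by linarith)]
  have : 0 ≤ s ^ 3 * (1 + 3 / 4 * s + s ^ 2 / 4) := by positivity
  nlinarith

lemma sub_cube_div_four_lt_sin {x : ℝ} (hx : 0 < x) : x - x ^ 3 / 4 < Real.sin x := by
  have := Real.sin_gt_sub_cube hx
  have : 0 < x ^ 3 := by positivity
  linarith

/-- The large-step case of the amplification bound. As `d < α`, one has `d / sin α ≤ d / sin d`,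
which is near `1`; the factor `2.51` is then absorbed by `4/π` times `√((1 + s)/(1 - s)) L(γ)`. For
small `d` the factor `L(γ)` is nearly `2`, and for larger `d` the root is large. -/
lemma mul_div_sin_le_phi {α d γ : ℝ} (hd : 0 < d) (hdα : d < α) (hαd : α + d < Real.pi / 2)
    (hγ : 0 < γ) (hγd : γ ≤ 1.6 * d) :
    2.51 * d / Real.sin α ≤ phi α d * (2 * L γ) := by
  have hpi := Real.pi_lt_d2
  have hpi0 := Real.pi_pos
  have hd1 : d < 0.7875 := by norm_num at hpi ⊢; linarith
  have hsind : d - d ^ 3 / 4 < Real.sin d := sub_cube_div_four_lt_sin hd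
  have hsinα : Real.sin d ≤ Real.sin α :=
    Real.sin_le_sin_of_le_of_le_pi_div_two (by linarith) (by linarith) hdα.le
  set s := Real.sin (α + d) with hs
  have hs1 : s < 1 := by
    rw [hs, ← Real.sin_pi_div_two]
    exact Real.sin_lt_sin_of_lt_of_le_pi_div_two (by linarith) le_rfl hαd
  have hd2 : d ^ 2 < 0.6202 := by norm_num at hd1 ⊢; nlinarith
  have hpos : 0 < 1 - d ^ 2 / 4 := by norm_num at hd2; linarith
  have hdiv : d / Real.sin α ≤ 1 / (1 - d ^ 2 / 4) := by
    have : 0 < d - d ^ 3 / 4 := by nlinarith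
    rw [div_le_div_iff₀ (by linarith) hpos]
    nlinarith
  suffices H : 2.51 * (1 / (1 - d ^ 2 / 4)) ≤ 1.2732 * √((1 + s) / (1 - s)) * L γ by
    have hpi' : 1.2732 ≤ 4 / Real.pi := by
      rw [le_div_iff₀ hpi0]
      have := Real.pi_lt_d4
      norm_num at this ⊢; linarith
    have hL := one_le_L γ
    calc 2.51 * d / Real.sin α = 2.51 * (d / Real.sin α) := by ring
      _ ≤ 2.51 * (1 / (1 - d ^ 2 / 4)) := by gcongr
      _ ≤ _ := H
      _ ≤ 4 / Real.pi * √((1 + s) / (1 - s)) * L γ := by gcongr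
      _ = _ := by rw [phi]; ring
  have hLγ := one_add_exp_neg_le_L hγ
  rw [mul_one_div, div_le_iff₀ hpos]
  -- Below `0.45`, `s ≥ sin 2d` and `L(γ) ≥ 2 - γ ≥ 2 - 1.6d` are used to first order; above it, the
  -- numerical values `s ≥ sin 0.9` and `L(γ) ≥ 1.2` suffice.
  rcases le_total d 0.45 with hd3 | hd3
  · have hs0 : 2 * d - 2 * d ^ 3 ≤ s := by
      have h1 := sub_cube_div_four_lt_sin (x := 2 * d) (by linarith)
      have h2 : Real.sin (2 * d) ≤ s :=
        Real.sin_le_sin_of_le_of_le_pi_div_two (by linarith) hαd.le (by linarith)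
      nlinarith
    have hd4 : d ^ 2 ≤ 0.2025 := by norm_num at hd3 ⊢; nlinarith
    have hcub : 0 ≤ 2 * d - 2 * d ^ 3 := by
      have : 0 ≤ d * (1 - d ^ 2) := mul_nonneg hd.le (by norm_num at hd4; linarith)
      nlinarith
    have hR : 1 + (2 * d - 2 * d ^ 3) ≤ √((1 + s) / (1 - s)) := by
      have := one_add_add_le_sqrt (hcub.trans hs0) hs1
      nlinarith [sq_nonneg s]
    have hL2 : 2 - 1.6 * d ≤ L γ := by
      have := Real.add_one_le_exp (-γ)
      linarith
    have h2 : 0 ≤ 2 - 1.6 * d := by norm_num at hd3 ⊢; linarith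
    have hprod : (1 + (2 * d - 2 * d ^ 3)) * (2 - 1.6 * d) ≤ √((1 + s) / (1 - s)) * L γ :=
      mul_le_mul hR hL2 h2 (by positivity)
    have e1 : 2 * (1 + 0.22 * d) ≤ (1 + (2 * d - 2 * d ^ 3)) * (2 - 1.6 * d) := by
      have e : (1 + (2 * d - 2 * d ^ 3)) * (2 - 1.6 * d) = 2 * (1 + 0.22 * d) +
          2 * d * (0.98 - 1.6 * d - 2 * d ^ 2 + 1.6 * d ^ 3) := by norm_num; ring
      rw [e]
      have : 0 ≤ 0.98 - 1.6 * d - 2 * d ^ 2 + 1.6 * d ^ 3 := by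
        norm_num at hd3 ⊢
        nlinarith [mul_nonneg (sub_nonneg.2 hd3) (sub_nonneg.2 hd3), mul_nonneg hd.le
          (mul_nonneg (sub_nonneg.2 hd3) (sub_nonneg.2 hd3)), mul_nonneg hd.le (sub_nonneg.2 hd3)]
      have := mul_nonneg hd.le this
      linarith
    have e2 : 1 ≤ (1 + 0.22 * d) * (1 - d ^ 2 / 4) := by
      have : 0 ≤ d * (0.22 - d / 4 - 0.055 * d ^ 2) := by
        refine mul_nonneg hd.le ?_
        norm_num at hd3 hd4 ⊢
        linarith
      norm_num at this ⊢
      nlinarith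
    have e3 := mul_le_mul_of_nonneg_right (e1.trans hprod) hpos.le
    norm_num at e2 e3 ⊢
    nlinarith
  · have hs0 : 0.717 ≤ s := by
      have h1 := sub_cube_div_four_lt_sin (x := 0.9) (by norm_num)
      have h2 : Real.sin 0.9 ≤ s :=
        Real.sin_le_sin_of_le_of_le_pi_div_two (by linarith) hαd.le
          (by norm_num at hd3 ⊢; linarith)
      norm_num at h1 h2 ⊢
      linarith
    have hR : 1.97 ≤ √((1 + s) / (1 - s)) := by
      have h0 : 0 ≤ s := by norm_num at hs0; linarith
      have := one_add_add_le_sqrt h0 hs1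
      norm_num at hs0 ⊢
      nlinarith
    have hL2 : 1.2 ≤ L γ := by
      have h1 := Real.add_one_le_exp (-γ / 4)
      have h2 : Real.exp (-γ) = Real.exp (-γ / 4) ^ 4 := by
        rw [← Real.exp_nat_mul]; congr 1; push_cast; ring
      have h3 : 0.68 ≤ Real.exp (-γ / 4) := by norm_num at hγd hd1 ⊢; linarith
      have h4 := pow_le_pow_left₀ (by norm_num) h3 4
      rw [← h2] at h4
      norm_num at h4 ⊢
      linarith
    have hprod : 1.97 * 1.2 ≤ √((1 + s) / (1 - s)) * L γ :=
      mul_le_mul hR hL2 (by norm_num) (by positivity)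
    have hd5 : 0.2025 ≤ d ^ 2 := by norm_num at hd3 ⊢; nlinarith
    have hd6 : 0.8449 ≤ 1 - d ^ 2 / 4 := by norm_num at hd2 ⊢; linarith
    have h7 := mul_le_mul hprod hd6 (by norm_num) (by positivity)
    norm_num at h7 ⊢
    nlinarith

/-- The amplification factor of an absolute error. -/
lemma mul_sum_mul_cosh_mul_exp_div_le {α d γ h : ℝ} {n : ℕ} (hd : 0 < d) (hdα : d < α)
    (hαd : α + d < Real.pi / 2) (hγ : 0 < γ) (hh : 0 < h) (hn : 1 ≤ n)
    (hγh : γ * h * Real.cosh (n * h) = 2 * Real.pi * d) :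
    (h * ∑ k ∈ Finset.Icc (-(n : ℤ)) n,
      γ * Real.cosh (k * h) * Real.exp (-(γ * Real.cosh (k * h)))) / (2 * Real.pi * Real.sin α) ≤
      PhiAbs α d * (2 * L γ) := by
  have hpi := Real.pi_pos
  have hsin : 0 < Real.sin α := Real.sin_pos_of_pos_of_lt_pi (by linarith) (by linarith)
  have hL := one_le_L γ
  rcases le_total h (8 / 5) with h8 | h8
  · have h1 := mul_sum_mul_cosh_mul_exp_le hγ hh h8 n
    calc _ ≤ 4 / Real.exp 1 * L γ / (2 * Real.pi * Real.sin α) := by gcongr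
      _ = 1 / (Real.pi * Real.exp 1 * Real.sin α) * (2 * L γ) := by field_simp; ring
      _ ≤ _ := by
        gcongr
        exact le_max_right _ _
  -- Here the exponentials are dropped and the sum of `cosh(kh)` is at most `2.51` times its last
  -- term, which the relation `hγh` evaluates.
  · have hnh : h ≤ n * h := le_mul_of_one_le_left hh.le (by exact_mod_cast hn)
    have hcosh : 2.46 ≤ Real.cosh (n * h) := by
      have h1 := exp_ge_of_ge (h8.trans hnh)
      have h2 := Real.exp_pos (-(n * h))
      rw [Real.cosh_eq]
      norm_num at h1 ⊢
      linarith
    have hγd : γ * h ≤ 2 * Real.pi * d / 2.46 := by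
      rw [le_div_iff₀ (by norm_num), ← hγh]
      gcongr
    -- The constant is `2π / (2.46 · 8/5)`, rounded up.
    have hγd' : γ ≤ 1.6 * d := by
      have h1 : γ * (8 / 5) ≤ γ * h := by gcongr
      have h2 := mul_le_mul_of_nonneg_right Real.pi_lt_d4.le hd.le
      norm_num at h2 hγd ⊢
      linarith
    have h1 := mul_div_sin_le_phi hd hdα hαd hγ hγd'
    calc _ ≤ (h * (γ * (2.51 * Real.cosh (n * h)))) / (2 * Real.pi * Real.sin α) := by
          gcongr
          refine le_trans ?_ (mul_le_mul_of_nonneg_left (sum_cosh_le h8 n) hγ.le)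
          rw [Finset.mul_sum]
          refine Finset.sum_le_sum fun k _ => ?_
          refine mul_le_of_le_one_right (mul_pos hγ (Real.cosh_pos _)).le ?_
          rw [Real.exp_le_one_iff, neg_nonpos]
          exact (mul_pos hγ (Real.cosh_pos _)).le
      _ = 2.51 * (γ * h * Real.cosh (n * h)) / (2 * Real.pi * Real.sin α) := by ring
      _ = 2.51 * d / Real.sin α := by rw [hγh]; field_simp
      _ ≤ _ := h1
      _ ≤ _ := by
        gcongr
        exact le_max_left _ _

/-! ### Uniqueness for the Laplace transform. -/

section Uniqueness

variable {X : Type*} [NormedAddCommGroup X] [NormedSpace ℂ X]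

lemma continuous_comp_neg_log {g : ℝ → ℝ} (hg : Continuous g) (hc : HasCompactSupport g) :
    Continuous fun y : ℝ => if y = 0 then 0 else g (-Real.log y) := by
  rw [continuous_iff_continuousAt]
  intro y
  rcases eq_or_ne y 0 with rfl | hy
  · have h1 : Tendsto (fun y => g (-Real.log y)) (𝓝[≠] 0) (𝓝 0) := by
      have h2 : Tendsto g atTop (𝓝 0) := by
        refine (hc.is_zero_at_infty).mono_left ?_
        exact atTop_le_cocompact
      exact h2.comp (tendsto_neg_atBot_atTop.comp Real.tendsto_log_nhdsNE_zero)
    have : ContinuousAt (Function.update (fun y => g (-Real.log y)) 0 0) 0 :=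
      continuousAt_update_same.2 h1
    convert this using 1
    ext y
    simp [Function.update_apply]
  · have h : ContinuousAt (fun y => g (-Real.log y)) y :=
      hg.continuousAt.comp (Real.continuousAt_log hy).neg
    refine h.congr ?_
    filter_upwards [isOpen_ne.mem_nhds hy] with z hz
    rw [if_neg hz]

/-- A function on `(0, ∞)` whose Laplace transform vanishes at all natural numbers is zero. -/
lemma ae_eq_zero_of_laplace_nat [CompleteSpace X] {F : ℝ → X} (hF : IntegrableOn F (Ioi 0))
    (h : ∀ m : ℕ, ∫ t in Ioi (0 : ℝ), Real.exp (-t) ^ m • F t = 0) :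
    ∀ᵐ t, t ∈ Ioi (0 : ℝ) → F t = 0 := by
  refine isOpen_Ioi.ae_eq_zero_of_integral_contDiff_smul_eq_zero hF.locallyIntegrableOn ?_
  intro g hg hgc hgs
  have h0 : g 0 = 0 := by
    by_contra h0
    exact lt_irrefl (0 : ℝ) (hgs (subset_tsupport g h0))
  have hset : ∫ t in Ioi (0 : ℝ), g t • F t = ∫ t, g t • F t := by
    refine setIntegral_eq_integral_of_forall_compl_eq_zero fun t ht => ?_
    have : g t = 0 := by
      by_contra h1
      exact ht (hgs (subset_tsupport g h1))
    rw [this, zero_smul]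
  rw [← hset]
  have hmeas : AEStronglyMeasurable F (volume.restrict (Ioi 0)) := hF.aestronglyMeasurable
  have hpoly : ∀ p : Polynomial ℝ, ∫ t in Ioi (0 : ℝ), p.eval (Real.exp (-t)) • F t = 0 := by
    intro p
    have hi : ∀ m : ℕ, IntegrableOn (fun t => Real.exp (-t) ^ m • F t) (Ioi 0) := fun m => by
      refine hF.norm.mono' ((show Continuous fun t => Real.exp (-t) ^ m by
        fun_prop).aestronglyMeasurable.smul hmeas) ?_
      filter_upwards [ae_restrict_mem measurableSet_Ioi] with t ht
      rw [norm_smul, norm_pow, Real.norm_of_nonneg (Real.exp_pos _).le]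
      exact mul_le_of_le_one_left (norm_nonneg _)
        (pow_le_one₀ (Real.exp_pos _).le (exp_neg_lt_one ht).le)
    simp_rw [Polynomial.eval_eq_sum_range, Finset.sum_smul, mul_smul]
    have hi' : ∀ m : ℕ, IntegrableOn (fun t => p.coeff m • Real.exp (-t) ^ m • F t) (Ioi 0) :=
      fun m => (hi m).smul (p.coeff m)
    rw [integral_finsetSum _ fun m _ => hi' m]
    refine Finset.sum_eq_zero fun m _ => ?_
    rw [integral_smul, h m, smul_zero]
  -- The substitution `y = e^{-t}` makes the test function continuous on `[0, 1]`. Weierstrass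
  -- approximation by polynomials in `e^{-t}`, against which `F` integrates to zero, then applies.
  set φ : ℝ → ℝ := fun y => if y = 0 then 0 else g (-Real.log y)
  have hφ : Continuous φ := continuous_comp_neg_log hg.continuous hgc
  have hφg : ∀ t : ℝ, φ (Real.exp (-t)) = g t := fun t => by
    simp [φ, (Real.exp_pos _).ne']
  refine norm_le_zero_iff.1 (le_of_forall_pos_le_add fun ε hε => ?_)
  set K := ∫ t in Ioi (0 : ℝ), ‖F t‖ with hK
  have hK0 : 0 ≤ K := integral_nonneg fun t => norm_nonneg _
  obtain ⟨p, hp⟩ := exists_polynomial_near_of_continuousOn 0 1 φ hφ.continuousOn (ε / (K + 1))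
    (by positivity)
  have hb : ∀ t ∈ Ioi (0 : ℝ), ‖g t • F t - p.eval (Real.exp (-t)) • F t‖ ≤
      ε / (K + 1) * ‖F t‖ := by
    intro t ht
    rw [← sub_smul, norm_smul, ← hφg t, norm_sub_rev]
    refine mul_le_mul_of_nonneg_right ?_ (norm_nonneg _)
    exact (hp _ ⟨(Real.exp_pos _).le, (exp_neg_lt_one ht).le⟩).le
  have hdiff : IntegrableOn (fun t => g t • F t - p.eval (Real.exp (-t)) • F t) (Ioi 0) := by
    refine (hF.norm.const_mul (ε / (K + 1))).mono' ?_ ?_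
    · exact (hg.continuous.aestronglyMeasurable.smul hmeas).sub
        ((show Continuous fun t => p.eval (Real.exp (-t)) by
          fun_prop).aestronglyMeasurable.smul hmeas)
    · filter_upwards [ae_restrict_mem measurableSet_Ioi] with t ht using hb t ht
  have hgF : IntegrableOn (fun t => g t • F t) (Ioi 0) := by
    obtain ⟨C, hC⟩ := hgc.exists_bound_of_continuous hg.continuous
    refine (hF.norm.const_mul C).mono' (hg.continuous.aestronglyMeasurable.smul hmeas)
      (Eventually.of_forall fun t => ?_)
    rw [norm_smul]
    exact mul_le_mul_of_nonneg_right (hC t) (norm_nonneg _)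
  have hpF : IntegrableOn (fun t => p.eval (Real.exp (-t)) • F t) (Ioi 0) := by
    convert hgF.sub hdiff using 1
    ext t
    simp
  have e : ∫ t in Ioi (0 : ℝ), g t • F t =
      ∫ t in Ioi (0 : ℝ), (g t • F t - p.eval (Real.exp (-t)) • F t) := by
    rw [integral_sub hgF hpF, hpoly p, sub_zero]
  rw [e, zero_add]
  calc _ ≤ ∫ t in Ioi (0 : ℝ), ε / (K + 1) * ‖F t‖ := by
        refine norm_integral_le_of_norm_le (hF.norm.const_mul _) ?_
        filter_upwards [ae_restrict_mem measurableSet_Ioi] with t ht using hb t ht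
    _ = ε / (K + 1) * K := integral_const_mul _ _
    _ ≤ ε := by
      rw [div_mul_eq_mul_div, div_le_iff₀ (by positivity)]
      nlinarith

end Uniqueness

/-! ### The winding integral along the hyperbola. -/

section LogIntegral

lemma one_div_cosh_le (x : ℝ) : 1 / Real.cosh x ≤ 2 * (1 + x ^ 2)⁻¹ := by
  rw [← div_eq_mul_inv, div_le_div_iff₀ (Real.cosh_pos _) (by positivity)]
  have := one_add_sq_div_two_le_cosh x
  nlinarith [sq_nonneg x]

lemma integrable_of_norm_le_div_cosh {E : Type*} [NormedAddCommGroup E] {f : ℝ → E}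
    (hf : Continuous f) {C : ℝ} (hC : 0 ≤ C) (h : ∀ x, ‖f x‖ ≤ C / Real.cosh x) :
    Integrable f := by
  refine (integrable_inv_one_add_sq.const_mul (C * 2)).mono' hf.aestronglyMeasurable
    (Eventually.of_forall fun x => (h x).trans ?_)
  rw [mul_assoc, div_eq_mul_one_div]
  exact mul_le_mul_of_nonneg_left (one_div_cosh_le x) hC

lemma tendsto_inv_cosh : Tendsto (fun x : ℝ => (Real.cosh x)⁻¹) atTop (𝓝 0) := by
  refine squeeze_zero (fun x => (inv_pos.2 (Real.cosh_pos x)).le) (fun x => ?_)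
    (tendsto_const_mul_inv_one_add_sq 2)
  rw [inv_eq_one_div]
  exact one_div_cosh_le x

lemma tendsto_sinh_div_cosh : Tendsto (fun x : ℝ => Real.sinh x / Real.cosh x) atTop (𝓝 1) := by
  have h : Tendsto (fun x : ℝ => Real.exp (-x) * (Real.cosh x)⁻¹) atTop (𝓝 (0 * 0)) :=
    (Real.tendsto_exp_atBot.comp tendsto_neg_atTop_atBot).mul tendsto_inv_cosh
  have := h.const_sub 1
  rw [mul_zero, sub_zero] at this
  refine this.congr fun x => ?_
  have hc := Real.cosh_pos x
  rw [← Real.cosh_sub_sinh]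
  field_simp
  ring

lemma T_eq (β x : ℝ) : T β x = 1 - Real.sin β * Real.cosh x -
    Real.cos β * Real.sinh x * Complex.I := by
  rw [← Complex.re_add_im (T β x), T_re, T_im]
  push_cast
  ring

variable {α σ : ℝ}

lemma T_mem_slitPlane (hα : 0 < α) (hα' : α < Real.pi / 2) (x : ℝ) :
    T α x ∈ Complex.slitPlane := by
  have hsin : Real.sin α < 1 := by
    rw [← Real.sin_pi_div_two]
    exact Real.sin_lt_sin_of_lt_of_le_pi_div_two (by linarith) le_rfl hα'
  have hcos : 0 < Real.cos α := Real.cos_pos_of_mem_Ioo ⟨by linarith, hα'⟩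
  rw [Complex.mem_slitPlane_iff, T_re, T_im]
  rcases eq_or_ne x 0 with rfl | hx
  · left; simpa using hsin
  · right
    simpa using ⟨hcos.ne', hx⟩

lemma le_re_sub_T (hσ : 1 ≤ σ) (x : ℝ) :
    Real.sin α * Real.cosh x ≤ ((σ : ℂ) - T α x).re := by
  rw [Complex.sub_re, Complex.ofReal_re, T_re]
  linarith

/-- Dividing both arguments by `cosh x > 0` leaves the difference of logarithms unchanged, and the
quotients tend to `-ζ` and `ζ`. The limit is `log(-ζ) - log ζ = ∓πi`, with the sign fixed by the end
`e = ±1` of the hyperbola. -/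
lemma tendsto_log_T_sub_log (hα : 0 < α) (hα' : α < Real.pi / 2) (hσ : 1 ≤ σ) {e : ℝ}
    (he : e = 1 ∨ e = -1) :
    Tendsto (fun x : ℝ => Complex.log (T α (e * x : ℝ)) - Complex.log (σ - T α (e * x : ℝ)))
      atTop (𝓝 (-(e * Real.pi * Complex.I))) := by
  have hcos : 0 < Real.cos α := Real.cos_pos_of_mem_Ioo ⟨by linarith, hα'⟩
  have hsin : 0 < Real.sin α := Real.sin_pos_of_pos_of_lt_pi hα (by linarith)
  set ζ : ℂ := Real.sin α + (e * Real.cos α : ℝ) * Complex.I with hζ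
  have hre : ζ.re = Real.sin α := by
    rw [hζ]; simp [-Complex.ofReal_sin, -Complex.ofReal_cos]
  have him : ζ.im = e * Real.cos α := by
    rw [hζ]; simp [-Complex.ofReal_sin, -Complex.ofReal_cos]
  have hcosh : ∀ x : ℝ, Real.cosh (e * x) = Real.cosh x := by
    intro x; rcases he with rfl | rfl <;> simp
  have hsinh : ∀ x : ℝ, Real.sinh (e * x) = e * Real.sinh x := by
    intro x; rcases he with rfl | rfl <;> simp
  have hc0 : ∀ x : ℝ, (Real.cosh x : ℂ) ≠ 0 := fun x => by
    exact_mod_cast (Real.cosh_pos x).ne'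
  have e1 : ∀ (c x : ℝ), ((Real.cosh x)⁻¹ : ℝ) * ((c : ℂ) - T α (e * x : ℝ)) =
      (((c - 1) * (Real.cosh x)⁻¹ : ℝ) : ℂ) + Real.sin α +
        (e * Real.cos α * (Real.sinh x / Real.cosh x) : ℝ) * Complex.I := by
    intro c x
    rw [T_eq, hcosh, hsinh]
    have := hc0 x
    push_cast at this ⊢
    field_simp
    ring
  have lim : ∀ c : ℝ, Tendsto (fun x : ℝ => (((Real.cosh x)⁻¹ : ℝ) : ℂ) *
      ((c : ℂ) - T α (e * x : ℝ))) atTop (𝓝 ζ) := by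
    intro c
    simp_rw [e1]
    have h1 : Tendsto (fun x : ℝ => (((c - 1) * (Real.cosh x)⁻¹ : ℝ) : ℂ)) atTop
        (𝓝 (((c - 1) * 0 : ℝ) : ℂ)) :=
      (Complex.continuous_ofReal.tendsto _).comp (tendsto_inv_cosh.const_mul _)
    have h2 : Tendsto (fun x : ℝ => ((e * Real.cos α * (Real.sinh x / Real.cosh x) : ℝ) : ℂ))
        atTop (𝓝 ((e * Real.cos α * 1 : ℝ) : ℂ)) :=
      (Complex.continuous_ofReal.tendsto _).comp (tendsto_sinh_div_cosh.const_mul _)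
    have := (h1.add_const (Real.sin α : ℂ)).add (h2.mul_const Complex.I)
    simpa [hζ] using this
  have lim0 := (lim 0).neg
  have hζs : ζ ∈ Complex.slitPlane := by left; rw [hre]; exact hsin
  have he0 : e ≠ 0 := by rcases he with rfl | rfl <;> norm_num
  have hζs' : -ζ ∈ Complex.slitPlane := by
    right; rw [Complex.neg_im, him]; simpa using ⟨he0, hcos.ne'⟩
  have l1 := (lim0.clog hζs').sub ((lim σ).clog hζs)
  have hval : Complex.log (-ζ) - Complex.log ζ = -(e * Real.pi * Complex.I) := by
    rw [Complex.log, Complex.log, norm_neg]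
    rcases he with rfl | rfl
    · rw [Complex.arg_neg_eq_arg_sub_pi_of_im_pos (by rw [him]; simpa using hcos)]
      push_cast; ring
    · rw [Complex.arg_neg_eq_arg_add_pi_of_im_neg (by rw [him]; simpa using hcos)]
      push_cast; ring
  rw [hval] at l1
  refine l1.congr fun x => ?_
  have hci : 0 < (Real.cosh x)⁻¹ := inv_pos.2 (Real.cosh_pos x)
  have hT := Complex.slitPlane_ne_zero (T_mem_slitPlane hα hα' (e * x))
  have hT' : (σ : ℂ) - T α (e * x : ℝ) ≠ 0 := by
    intro h0
    have := le_re_sub_T (α := α) hσ (e * x)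
    rw [h0, Complex.zero_re] at this
    nlinarith [mul_pos hsin (Real.cosh_pos (e * x))]
  rw [Complex.log_ofReal_mul hci hT', Complex.ofReal_zero, zero_sub, mul_neg, neg_neg,
    Complex.log_ofReal_mul hci hT]
  ring

lemma continuous_T_real (β : ℝ) : Continuous fun x : ℝ => T β x :=
  (differentiable_T β).continuous.comp Complex.continuous_ofReal

lemma continuous_T'_real (β : ℝ) : Continuous fun x : ℝ => T' β x :=
  (differentiable_T' β).continuous.comp Complex.continuous_ofReal

lemma sin_mem_Ioo (hα : 0 < α) (hα' : α < Real.pi / 2) : Real.sin α ∈ Ioo (0 : ℝ) 1 := by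
  refine ⟨Real.sin_pos_of_pos_of_lt_pi hα (by linarith [Real.pi_pos]), ?_⟩
  rw [← Real.sin_pi_div_two]
  exact Real.sin_lt_sin_of_lt_of_le_pi_div_two (by linarith) le_rfl hα'

lemma norm_sub_T_ge (hσ : 1 ≤ σ) (x : ℝ) : Real.sin α * Real.cosh x ≤ ‖(σ : ℂ) - T α x‖ :=
  (le_re_sub_T hσ x).trans (Complex.re_le_norm _)

lemma sub_T_ne_zero (hα : 0 < α) (hα' : α < Real.pi / 2) (hσ : 1 ≤ σ) (x : ℝ) :
    (σ : ℂ) - T α x ≠ 0 := by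
  have h1 := norm_sub_T_ge (α := α) hσ x
  have h2 := mul_pos (sin_mem_Ioo hα hα').1 (Real.cosh_pos x)
  exact norm_pos_iff.1 (h2.trans_le h1)

lemma integrable_logDeriv_T (hα : 0 < α) (hα' : α < Real.pi / 2) (hσ : 1 ≤ σ) :
    Integrable fun x : ℝ => σ * T' α x / (T α x * (σ - T α x)) := by
  obtain ⟨hs0, hs1⟩ := sin_mem_Ioo hα hα'
  set R := √((1 + Real.sin α) / (1 - Real.sin α))
  have hT0 : ∀ x : ℝ, T α x ≠ 0 := fun x => Complex.slitPlane_ne_zero (T_mem_slitPlane hα hα' x)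
  refine integrable_of_norm_le_div_cosh (C := σ * R / Real.sin α) ?_ (by positivity) fun x => ?_
  · refine Continuous.div (continuous_const.mul (continuous_T'_real α))
      ((continuous_T_real α).mul (continuous_const.sub (continuous_T_real α))) fun x => ?_
    exact mul_ne_zero (hT0 x) (sub_T_ne_zero hα hα' hσ x)
  · have h1 := norm_T'_le x le_rfl hs0.le hs1
    have h2 := norm_sub_T_ge (α := α) hσ x
    have h3 : 0 < ‖T α x‖ := norm_pos_iff.2 (hT0 x)
    have hc := Real.cosh_pos x
    rw [norm_div, norm_mul, norm_mul, Complex.norm_of_nonneg (by linarith), div_div]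
    calc σ * ‖T' α x‖ / (‖T α x‖ * ‖(σ : ℂ) - T α x‖)
        ≤ σ * (R * ‖T α x‖) / (‖T α x‖ * (Real.sin α * Real.cosh x)) := by gcongr
      _ = _ := by field_simp

/-- The integrand is the derivative of `log T - log(σ - T)`. Neither logarithm meets its cut: `T`
avoids the negative axis and `σ - T` has positive real part. -/
lemma integral_logDeriv_T (hα : 0 < α) (hα' : α < Real.pi / 2) (hσ : 1 ≤ σ) :
    ∫ x : ℝ, σ * T' α x / (T α x * (σ - T α x)) = -(2 * Real.pi * Complex.I) := by
  have hT0 : ∀ x : ℝ, T α x ≠ 0 := fun x => Complex.slitPlane_ne_zero (T_mem_slitPlane hα hα' x)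
  have hder : ∀ x : ℝ, HasDerivAt (fun x : ℝ => Complex.log (T α x) - Complex.log (σ - T α x))
      (σ * T' α x / (T α x * (σ - T α x))) x := by
    intro x
    have h1 : HasDerivAt (fun x : ℝ => T α x) (T' α x) x := (hasDerivAt_T α x).comp_ofReal
    have h2 := (h1.clog_real (T_mem_slitPlane hα hα' x)).sub
      ((h1.const_sub (σ : ℂ)).clog_real (Or.inl ((mul_pos (sin_mem_Ioo hα hα').1
        (Real.cosh_pos x)).trans_le (le_re_sub_T hσ x))))
    refine h2.congr_deriv ?_
    have := hT0 x
    have := sub_T_ne_zero hα hα' hσ x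
    field_simp
    ring
  have l1 := tendsto_log_T_sub_log hα hα' hσ (Or.inl rfl : (1 : ℝ) = 1 ∨ _)
  have l2 := tendsto_log_T_sub_log hα hα' hσ (Or.inr rfl : (-1 : ℝ) = 1 ∨ _)
  have l2' := l2.comp tendsto_neg_atBot_atTop
  simp only [Function.comp_def, one_mul, neg_mul, neg_neg] at l1 l2'
  rw [integral_of_hasDerivAt_of_tendsto hder (integrable_logDeriv_T hα hα' hσ) l2' l1]
  push_cast
  ring

end LogIntegral

/-! ### The inversion integral over a hyperbola. -/

section

variable {X : Type*} [NormedAddCommGroup X] [NormedSpace ℂ X]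

/-- The integrand of the inversion integral over the branch of hyperbola `x ↦ lam * T α x`. -/
def contourIntegrand (U : ℂ → X) (α lam t : ℝ) (w : ℂ) : X :=
  (-(lam / (2 * Real.pi * Complex.I)) * Complex.exp (t * (lam * T α w)) * T' α w) •
    U (lam * T α w)

/-- The inversion integral over the branch of hyperbola `x ↦ lam * T α x`. -/
def inversion (U : ℂ → X) (α lam t : ℝ) : X := ∫ x : ℝ, contourIntegrand U α lam t x

lemma contourIntegrand_add_mul_I (U : ℂ → X) (α lam t x y : ℝ) :
    contourIntegrand U α lam t (x + y * Complex.I) = contourIntegrand U (α - y) lam t x := by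
  simp only [contourIntegrand, T_add_mul_I, T'_add_mul_I]

variable {δ M : ℝ} {U : ℂ → X}

lemma sin_lt_cos {β : ℝ} (hδ : 0 < δ) (h1 : -(Real.pi / 2) ≤ β) (h2 : β < Real.pi / 2 - δ) :
    Real.sin β < Real.cos δ := by
  rw [← Real.sin_pi_div_two_sub]
  exact Real.sin_lt_sin_of_lt_of_le_pi_div_two h1 (by linarith) h2

lemma norm_contourIntegrand_le (hδ : 0 < δ) (hδ' : δ < Real.pi / 2) (hU : IsSectorial δ M U)
    (hM : 0 < M) {lam β s : ℝ} (hlam : 0 < lam) (hβ : Real.sin β < Real.cos δ)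
    (hβs : Real.sin β ≤ s) (hs0 : 0 ≤ s) (hs1 : s < 1) (t x : ℝ) :
    ‖contourIntegrand U β lam t x‖ ≤ M / (2 * Real.pi) * √((1 + s) / (1 - s)) *
      Real.exp (lam * t * (1 - Real.sin β * Real.cosh x)) := by
  have hz := smul_T_notMem_sector hδ hδ' hlam hβ x
  have hUz := hU.2 _ hz
  have hT : 0 < ‖T β x‖ := by
    rw [norm_T]; linarith [Real.one_le_cosh x]
  have hT' := norm_T'_le x hβs hs0 hs1
  have hpi := Real.pi_pos
  rw [norm_mul, Complex.norm_of_nonneg hlam.le] at hUz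
  have e1 : ‖-((lam : ℂ) / (2 * Real.pi * Complex.I))‖ = lam / (2 * Real.pi) := by
    rw [norm_neg, norm_div, norm_mul, norm_mul, Complex.norm_I, Complex.norm_of_nonneg hlam.le,
      Complex.norm_of_nonneg hpi.le, Complex.norm_two, mul_one]
  have e2 : ‖Complex.exp (t * (lam * T β x))‖ =
      Real.exp (lam * t * (1 - Real.sin β * Real.cosh x)) := by
    rw [Complex.norm_exp, Complex.re_ofReal_mul, Complex.re_ofReal_mul, T_re]
    congr 1; ring
  rw [contourIntegrand, norm_smul, norm_mul, norm_mul, e1, e2]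
  calc _ ≤ lam / (2 * Real.pi) * Real.exp (lam * t * (1 - Real.sin β * Real.cosh x)) *
        (√((1 + s) / (1 - s)) * ‖T β x‖) * (M / (lam * ‖T β x‖)) := by gcongr
    _ = _ := by field_simp

lemma differentiableAt_comp_T (hδ : 0 < δ) (hδ' : δ < Real.pi / 2) {V : ℂ → X}
    (hV : DifferentiableOn ℂ V (sector δ)ᶜ) {α lam : ℝ} {w : ℂ}
    (hw : (lam * T α w : ℂ) ∉ sector δ) :
    DifferentiableAt ℂ (fun w => V (lam * T α w)) w :=
  DifferentiableAt.comp (g := V) (f := fun w => (lam * T α w : ℂ)) w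
    (hV.differentiableAt ((isOpen_compl_sector hδ hδ').mem_nhds hw))
    (((differentiable_T α) w).const_mul _)

lemma differentiableAt_contourIntegrand (hδ : 0 < δ) (hδ' : δ < Real.pi / 2)
    (hU : IsSectorial δ M U) {α lam : ℝ} (t : ℝ) {w : ℂ} (hw : (lam * T α w : ℂ) ∉ sector δ) :
    DifferentiableAt ℂ (contourIntegrand U α lam t) w := by
  refine DifferentiableAt.smul ?_ (differentiableAt_comp_T hδ hδ' hU.1 hw)
  have h1 := differentiable_T α w
  have h2 := differentiable_T' α w
  fun_prop

lemma continuous_comp_T (hδ : 0 < δ) (hδ' : δ < Real.pi / 2) {V : ℂ → X}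
    (hV : DifferentiableOn ℂ V (sector δ)ᶜ) {β lam : ℝ} (hlam : 0 < lam)
    (hβ : Real.sin β < Real.cos δ) : Continuous fun x : ℝ => V (lam * T β x) :=
  hV.continuousOn.comp_continuous (continuous_const.mul (continuous_T_real β))
    fun x => smul_T_notMem_sector hδ hδ' hlam hβ x

lemma continuous_contourIntegrand (hδ : 0 < δ) (hδ' : δ < Real.pi / 2) (hU : IsSectorial δ M U)
    {β lam : ℝ} (hlam : 0 < lam) (hβ : Real.sin β < Real.cos δ) :
    Continuous fun p : ℝ × ℝ => contourIntegrand U β lam p.1 p.2 := by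
  have h1 := (continuous_comp_T hδ hδ' hU.1 hlam hβ).comp (continuous_snd (X := ℝ))
  have h2 := (continuous_T_real β).comp (continuous_snd (X := ℝ))
  have h3 := (continuous_T'_real β).comp (continuous_snd (X := ℝ))
  simp only [Function.comp_def] at h1 h2 h3
  refine Continuous.smul (f := fun p : ℝ × ℝ => -((lam : ℂ) / (2 * Real.pi * Complex.I)) *
    Complex.exp (p.1 * (lam * T β p.2)) * T' β p.2) ?_ h1
  fun_prop

lemma continuous_contourIntegrand_line (hδ : 0 < δ) (hδ' : δ < Real.pi / 2)
    (hU : IsSectorial δ M U) {β lam : ℝ} (hlam : 0 < lam) (hβ : Real.sin β < Real.cos δ) (t : ℝ) :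
    Continuous fun x : ℝ => contourIntegrand U β lam t x :=
  (continuous_contourIntegrand hδ hδ' hU hlam hβ).comp (Continuous.prodMk_right t)

lemma continuousOn_inversion (hδ : 0 < δ) (hδ' : δ < Real.pi / 2) (hU : IsSectorial δ M U)
    (hM : 0 < M) {α lam : ℝ} (hlam : 0 < lam) (hα : 0 < α) (hαδ : α < Real.pi / 2 - δ) :
    ContinuousOn (inversion U α lam) (Ioi 0) := by
  intro t ht
  have ht : 0 < t := ht
  refine ContinuousAt.continuousWithinAt ?_
  obtain ⟨hs0, hs1⟩ := sin_mem_Ioo hα (by linarith)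
  have hβ := sin_lt_cos hδ (by linarith) hαδ
  set C := M / (2 * Real.pi) * √((1 + Real.sin α) / (1 - Real.sin α))
  have hcont := continuous_contourIntegrand hδ hδ' hU hlam hβ
  refine continuousAt_of_dominated (bound := fun x => C * Real.exp (lam * (2 * t)) *
    Real.exp (-(lam * (t / 2) * Real.sin α * Real.cosh x))) ?_ ?_ ?_ ?_
  · exact Eventually.of_forall fun t =>
      (continuous_contourIntegrand_line hδ hδ' hU hlam hβ t).aestronglyMeasurable
  -- On `(t/2, 2t)` the upper end bounds the growing factor and the lower end the decaying one.
  · filter_upwards [Ioo_mem_nhds (show t / 2 < t by linarith) (show t < 2 * t by linarith)]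
      with r hr
    refine Eventually.of_forall fun x => ?_
    refine (norm_contourIntegrand_le hδ hδ' hU hM hlam hβ le_rfl hs0.le hs1 r x).trans ?_
    rw [mul_assoc C, ← Real.exp_add]
    refine mul_le_mul_of_nonneg_left (Real.exp_le_exp.2 ?_) (by positivity)
    have h1 : lam * r ≤ lam * (2 * t) := by gcongr; exact hr.2.le
    have h2 : lam * (t / 2) * (Real.sin α * Real.cosh x) ≤ lam * r * (Real.sin α * Real.cosh x) :=
      mul_le_mul_of_nonneg_right (by gcongr; exact hr.1.le)
        (mul_pos hs0 (Real.cosh_pos x)).le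
    linarith
  · exact (integrable_exp_neg_mul_cosh (by positivity)).const_mul _
  · refine Eventually.of_forall fun x => Continuous.continuousAt ?_
    exact hcont.comp (Continuous.prodMk_left x)

/-! ### Cauchy's formula on the hyperbola and identification with `u`. -/

section Resolvent

variable {α lam s : ℝ}

lemma norm_id_smul_le (hU : IsSectorial δ M U) (hM : 0 < M) {z : ℂ} (hz : z ∉ sector δ) :
    ‖z • U z‖ ≤ M := by
  rw [norm_smul]
  rcases eq_or_ne z 0 with rfl | h0
  · simpa using hM.le
  · have := hU.2 z hz
    rwa [le_div_iff₀ (norm_pos_iff.2 h0), mul_comm] at this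

lemma T_neg_pi_div_two (x : ℝ) : T (-(Real.pi / 2)) x = 1 + Real.cosh x := by
  rw [T_eq]; simp

lemma T'_neg_pi_div_two (x : ℝ) : T' (-(Real.pi / 2)) x = Real.sinh x := by
  rw [T', mul_comm Complex.I (x : ℂ), Complex.cos_add_mul_I, ← Complex.ofReal_cos,
    ← Complex.ofReal_sin, Real.cos_neg, Real.sin_neg, Real.cos_pi_div_two, Real.sin_pi_div_two]
  push_cast
  linear_combination (-Complex.sinh x) * Complex.I_sq

variable [CompleteSpace X]

/-- The contour can be moved into a ray, which it traverses in both directions. -/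
lemma integral_logDeriv_smul_dslope_eq_zero (hδ : 0 < δ) (hδ' : δ < Real.pi / 2)
    (hU : IsSectorial δ M U) (hM : 0 < M) (hlam : 0 < lam) (hα : 0 < α)
    (hαδ : α < Real.pi / 2 - δ) (hs : lam ≤ s)
    (hint : Integrable fun x : ℝ =>
      (T' α x / T α x) • dslope (fun z => z • U z) (s : ℂ) (lam * T α x)) :
    ∫ x : ℝ, (T' α x / T α x) • dslope (fun z => z • U z) (s : ℂ) (lam * T α x) = 0 := by
  have hpi := Real.pi_pos
  have hs0 : 0 < s := hlam.trans_le hs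
  -- The divided difference removes the pole at `s`. It is taken of `z U(z)`, which is bounded by
  -- `M`, so that `D` decays like `1/|z|`.
  set D := dslope (fun z => z • U z) (s : ℂ) with hD
  have hsS := notMem_sector_of_pos hδ hδ' hs0
  have hDd : DifferentiableOn ℂ D (sector δ)ᶜ :=
    (Complex.differentiableOn_dslope ((isOpen_compl_sector hδ hδ').mem_nhds hsS)).2
      (differentiableOn_id.smul hU.1)
  set G : ℂ → X := fun w => (T' α w / T α w) • D (lam * T α w) with hG
  have hGI : ∀ x y : ℝ, G (x + y * Complex.I) =
      (T' (α - y) x / T (α - y) x) • D (lam * T (α - y) x) := fun x y => by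
    simp only [hG, T_add_mul_I, T'_add_mul_I]
  -- The shift by `b` carries the angle from `α` to `-π/2`, where `T = 1 + cosh x` is real and the
  -- hyperbola has folded onto a ray.
  set b := α + Real.pi / 2 with hb
  have hb0 : 0 ≤ b := by linarith
  have hsin : ∀ y ∈ uIcc 0 b, Real.sin (α - y) < Real.cos δ := by
    intro y hy
    rw [uIcc_of_le hb0] at hy
    exact sin_lt_cos hδ (by linarith [hy.2]) (by linarith [hy.1])
  have hdiff : DifferentiableOn ℂ G {z | z.im ∈ uIcc 0 b} := by
    intro w hw
    have hw' := smul_T_notMem_sector hδ hδ' hlam (hsin _ hw) w.re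
    rw [← T_add_mul_I, Complex.re_add_im] at hw'
    refine DifferentiableAt.differentiableWithinAt ?_
    refine DifferentiableAt.smul (((differentiable_T' α) w).div ((differentiable_T α) w) ?_)
      (differentiableAt_comp_T hδ hδ' hDd hw')
    intro h0
    rw [h0, mul_zero] at hw'
    exact hw' (by simp [sector, hδ.le])
  set σ := s / lam with hσ
  have hσ1 : 1 ≤ σ := (one_le_div hlam).2 hs
  -- For `|x| ≥ 4σ` one has `|z - s| ≥ λx²/4` for `z = λ T(x)` at every angle of the shift, so the
  -- vertical sides contribute `O(1/x²)`.
  have hbound : ∀ x y : ℝ, y ∈ uIcc 0 b → 4 * σ ≤ |x| →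
      ‖G (x + y * Complex.I)‖ ≤ (fun r : ℝ => 16 * M / lam * (r ^ 2)⁻¹) |x| := by
    intro x y hy hx
    have hw := smul_T_notMem_sector hδ hδ' hlam (hsin _ hy) x
    have hx2 : 16 * σ ^ 2 ≤ x ^ 2 := by
      rw [← sq_abs x]; nlinarith
    have hc := one_add_sq_div_two_le_cosh x
    have hsl : s = lam * σ := by rw [hσ]; field_simp
    have hT : Real.cosh x - 1 ≤ ‖T (α - y) x‖ := by
      rw [norm_T]; linarith [Real.sin_le_one (α - y)]
    have hzs : lam * (x ^ 2 / 4) ≤ ‖(lam * T (α - y) x : ℂ) - s‖ := by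
      have h1 := norm_sub_norm_le (lam * T (α - y) x : ℂ) s
      rw [norm_mul, Complex.norm_of_nonneg hlam.le, Complex.norm_of_nonneg hs0.le] at h1
      refine le_trans ?_ h1
      have h2 := mul_le_mul_of_nonneg_left hT hlam.le
      rw [hsl]
      nlinarith
    have hxpos : 0 < x ^ 2 := by nlinarith
    have hzs0 : 0 < lam * (x ^ 2 / 4) := by positivity
    have hne : (lam * T (α - y) x : ℂ) ≠ s := fun h => by
      rw [h, sub_self, norm_zero] at hzs
      linarith
    have hDle : ‖D (lam * T (α - y) x)‖ ≤ 2 * M / (lam * (x ^ 2 / 4)) := by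
      rw [hD, dslope_of_ne _ hne, slope_def_module, norm_smul, norm_inv, inv_mul_eq_div]
      have h1 := norm_sub_le ((lam * T (α - y) x : ℂ) • U (lam * T (α - y) x)) ((s : ℂ) • U s)
      have h2 := norm_id_smul_le hU hM hw
      have h3 := norm_id_smul_le hU hM hsS
      gcongr
      linarith
    have hTT : ‖T' (α - y) x / T (α - y) x‖ ≤ 2 := by
      have h1 := norm_T'_le_cosh (α - y) x
      rw [norm_div, div_le_iff₀ (by nlinarith)]
      nlinarith
    rw [hGI, norm_smul]
    calc _ ≤ 2 * (2 * M / (lam * (x ^ 2 / 4))) := by gcongr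
      _ = _ := by simp only [sq_abs]; field_simp; ring
  have hB : Tendsto (fun r : ℝ => 16 * M / lam * (r ^ 2)⁻¹) atTop (𝓝 0) := by
    simpa using (tendsto_inv_atTop_zero.comp (tendsto_pow_atTop (α := ℝ) two_ne_zero)).const_mul
      (16 * M / lam)
  have hlim := tendsto_integral_line_sub hdiff hB hbound
  have htop : ∀ R : ℝ, ∫ x in -R..R, G (x + b * Complex.I) = 0 := by
    intro R
    have hodd : ∀ x : ℝ, G ((-x : ℝ) + b * Complex.I) = -G (x + b * Complex.I) := by
      intro x
      rw [hGI, hGI, show α - b = -(Real.pi / 2) by rw [hb]; ring, T_neg_pi_div_two,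
        T'_neg_pi_div_two, T_neg_pi_div_two, T'_neg_pi_div_two, Real.cosh_neg, Real.sinh_neg,
        Complex.ofReal_neg, neg_div, neg_smul]
    have h1 := intervalIntegral.integral_comp_neg (a := -R) (b := R)
      (fun x : ℝ => G (x + b * Complex.I))
    rw [neg_neg] at h1
    simp_rw [hodd] at h1
    rw [intervalIntegral.integral_neg, neg_eq_iff_add_eq_zero, ← two_smul ℝ] at h1
    exact (smul_eq_zero.1 h1).resolve_left two_ne_zero
  simp only [htop, sub_zero] at hlim
  exact tendsto_nhds_unique
    (intervalIntegral_tendsto_integral hint tendsto_neg_atTop_atBot tendsto_id) hlim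

/-- Cauchy's integral formula for the exterior of the sector. The vanishing integral of the divided
difference of `z U(z)` splits into the winding integral times `U(s)` minus the Cauchy integral of
`U`; dividing by `T` makes both pieces absolutely integrable. -/
lemma integral_resolvent_smul_contourIntegrand (hδ : 0 < δ) (hδ' : δ < Real.pi / 2)
    (hU : IsSectorial δ M U) (hM : 0 < M) (hlam : 0 < lam) (hα : 0 < α)
    (hαδ : α < Real.pi / 2 - δ) (hs : lam ≤ s) :
    ∫ x : ℝ, ((s : ℂ) - lam * T α x)⁻¹ • contourIntegrand U α lam 0 x = U s := by
  have hs0 : 0 < s := hlam.trans_le hs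
  have hα' : α < Real.pi / 2 := by linarith
  have hβ := sin_lt_cos hδ (by linarith) hαδ
  obtain ⟨hsin0, hsin1⟩ := sin_mem_Ioo hα hα'
  set σ := s / lam with hσ
  have hσ1 : 1 ≤ σ := (one_le_div hlam).2 hs
  have hlam0 : (lam : ℂ) ≠ 0 := by exact_mod_cast hlam.ne'
  have hsl : (s : ℂ) = lam * σ := by
    rw [hσ]; push_cast; field_simp
  have hT0 : ∀ x : ℝ, T α x ≠ 0 := fun x => Complex.slitPlane_ne_zero (T_mem_slitPlane hα hα' x)
  have hσT : ∀ x : ℝ, (σ : ℂ) - T α x ≠ 0 := sub_T_ne_zero hα hα' hσ1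
  set J : ℝ → ℂ := fun x => σ * T' α x / (T α x * (σ - T α x)) with hJ
  set P : ℝ → X := fun x => (T' α x / (σ - T α x)) • U (lam * T α x) with hP
  have hJi : Integrable fun x => J x • U s := (integrable_logDeriv_T hα hα' hσ1).smul_const _
  have hPi : Integrable P := by
    set R := √((1 + Real.sin α) / (1 - Real.sin α))
    refine integrable_of_norm_le_div_cosh (C := R * M / (lam * Real.sin α)) ?_ (by positivity)
      fun x => ?_
    · exact ((continuous_T'_real α).div (continuous_const.sub (continuous_T_real α)) hσT).smul
        (continuous_comp_T hδ hδ' hU.1 hlam hβ)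
    · have h1 := norm_T'_le x le_rfl hsin0.le hsin1
      have h2 := norm_sub_T_ge (α := α) hσ1 x
      have h3 : 0 < ‖T α x‖ := norm_pos_iff.2 (hT0 x)
      have h4 := hU.2 _ (smul_T_notMem_sector hδ hδ' hlam hβ x)
      have hc := Real.cosh_pos x
      rw [norm_mul, Complex.norm_of_nonneg hlam.le] at h4
      rw [hP, norm_smul, norm_div]
      calc _ ≤ R * ‖T α x‖ / (Real.sin α * Real.cosh x) * (M / (lam * ‖T α x‖)) := by gcongr
        _ = _ := by field_simp
  have hdec : ∀ x : ℝ, (T' α x / T α x) • dslope (fun z => z • U z) (s : ℂ) (lam * T α x) =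
      J x • U s - P x := by
    intro x
    have h1 := hT0 x
    have h2 := hσT x
    have hne : (lam * T α x : ℂ) ≠ s := by
      rw [hsl]
      intro h
      exact h2 (by rw [mul_left_cancel₀ hlam0 h, sub_self])
    have h3 : (lam : ℂ) * T α x - lam * σ ≠ 0 := by
      rw [← mul_sub]
      refine mul_ne_zero hlam0 ?_
      rwa [← neg_sub, neg_ne_zero]
    have h4 : T α x - σ ≠ 0 := by rwa [← neg_sub, neg_ne_zero]
    rw [dslope_of_ne _ hne, slope_def_module, hJ, hP]
    simp only [smul_sub, smul_smul]
    rw [← neg_sub_neg, ← neg_smul, ← neg_smul, hsl]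
    congr 2
    · field_simp
      ring
    · field_simp
      ring
  have hGi : Integrable fun x : ℝ =>
      (T' α x / T α x) • dslope (fun z => z • U z) (s : ℂ) (lam * T α x) := by
    simp_rw [hdec]; exact hJi.sub hPi
  have hzero := integral_logDeriv_smul_dslope_eq_zero hδ hδ' hU hM hlam hα hαδ hs hGi
  simp_rw [hdec] at hzero
  rw [integral_sub hJi hPi, sub_eq_zero, integral_smul_const, hJ,
    integral_logDeriv_T hα hα' hσ1] at hzero
  have hpi : (2 * Real.pi * Complex.I : ℂ) ≠ 0 := by
    simp [Real.pi_ne_zero]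
  have e : ∀ x : ℝ, ((s : ℂ) - lam * T α x)⁻¹ • contourIntegrand U α lam 0 x =
      (-(1 / (2 * Real.pi * Complex.I)) : ℂ) • P x := by
    intro x
    have h2 := hσT x
    rw [contourIntegrand, hP]
    simp only [smul_smul]
    congr 1
    rw [hsl, ← mul_sub]
    simp only [Complex.ofReal_zero, zero_mul, Complex.exp_zero, mul_one]
    field_simp
  simp_rw [e]
  rw [integral_smul, ← hzero, smul_smul]
  have : (-(1 / (2 * Real.pi * Complex.I)) * -(2 * Real.pi * Complex.I) : ℂ) = 1 := by
    field_simp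
  rw [this, one_smul]

/-- For `s ≥ λ` the exponent `λT(x) - s` has real part at most `-λ sin α cosh x`. This makes the
double integral absolutely convergent, and integrating first in `t` produces the kernel `(s -
λT)⁻¹`. -/
lemma laplace_inversion (hδ : 0 < δ) (hδ' : δ < Real.pi / 2)
    (hU : IsSectorial δ M U) (hM : 0 < M) (hlam : 0 < lam) (hα : 0 < α)
    (hαδ : α < Real.pi / 2 - δ) (hs : lam ≤ s) :
    IntegrableOn (fun t : ℝ => Complex.exp (-(s * t)) • inversion U α lam t) (Ioi 0) ∧
      ∫ t in Ioi (0 : ℝ), Complex.exp (-(s * t)) • inversion U α lam t = U s := by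
  have hα' : α < Real.pi / 2 := by linarith
  have hβ := sin_lt_cos hδ (by linarith) hαδ
  obtain ⟨hsin0, hsin1⟩ := sin_mem_Ioo hα hα'
  set C := M / (2 * Real.pi) * √((1 + Real.sin α) / (1 - Real.sin α)) with hC
  have hC0 : 0 ≤ C := by positivity
  set c : ℝ → X := fun x => contourIntegrand U α lam 0 x with hc
  have hcC : ∀ x, ‖c x‖ ≤ C := fun x => by
    simpa using norm_contourIntegrand_le hδ hδ' hU hM hlam hβ le_rfl hsin0.le hsin1 0 x
  have hccont : Continuous c := continuous_contourIntegrand_line hδ hδ' hU hlam hβ 0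
  set F : ℝ → ℝ → X := fun t x => Complex.exp ((lam * T α x - s) * t) • c x with hF
  have hFe : ∀ t x : ℝ, Complex.exp (-(s * t)) • contourIntegrand U α lam t x = F t x := by
    intro t x
    rw [hF, hc]
    simp only [contourIntegrand, smul_smul]
    congr 1
    rw [sub_mul, sub_eq_add_neg, Complex.exp_add, Complex.ofReal_zero, zero_mul, Complex.exp_zero,
      show (lam : ℂ) * T α x * t = t * (lam * T α x) by ring]
    ring
  have hre : ∀ x : ℝ, ((lam : ℂ) * T α x - s).re ≤ -(lam * Real.sin α * Real.cosh x) := by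
    intro x
    rw [Complex.sub_re, Complex.re_ofReal_mul, T_re, Complex.ofReal_re]
    nlinarith
  have hpos : ∀ x : ℝ, 0 < lam * Real.sin α * Real.cosh x := fun x => by
    have := Real.cosh_pos x
    positivity
  have hre0 : ∀ x : ℝ, ((lam : ℂ) * T α x - s).re < 0 := fun x => by
    linarith [hre x, hpos x]
  have hFcont : Continuous (Function.uncurry F) := by
    have h1 := hccont.comp (continuous_snd (X := ℝ))
    have h2 := (continuous_T_real α).comp (continuous_snd (X := ℝ))
    simp only [Function.comp_def] at h1 h2
    unfold Function.uncurry
    rw [hF]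
    fun_prop
  have hnorm : ∀ t x : ℝ, ‖F t x‖ = Real.exp (((lam : ℂ) * T α x - s).re * t) * ‖c x‖ := by
    intro t x
    rw [hF, norm_smul, Complex.norm_exp]
    congr 2
    rw [mul_comm, Complex.re_ofReal_mul, mul_comm]
  have hFi : Integrable (Function.uncurry F) ((volume.restrict (Ioi 0)).prod volume) := by
    rw [integrable_prod_iff' hFcont.aestronglyMeasurable]
    constructor
    · refine Eventually.of_forall fun x => ?_
      exact (integrableOn_exp_mul_complex_Ioi (hre0 x) 0).smul_const (c x)
    · have e : ∀ x : ℝ, ∫ t in Ioi (0 : ℝ), ‖Function.uncurry F (t, x)‖ =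
          ‖c x‖ / -((lam : ℂ) * T α x - s).re := by
        intro x
        simp only [Function.uncurry, hnorm]
        rw [integral_mul_const, integral_exp_mul_Ioi (hre0 x)]
        simp only [mul_zero, Real.exp_zero]
        rw [neg_div, div_neg]
        ring
      simp_rw [e]
      refine integrable_of_norm_le_div_cosh (C := C / (lam * Real.sin α)) ?_ (by positivity)
        fun x => ?_
      · refine hccont.norm.div ?_ fun x => (neg_pos.2 (hre0 x)).ne'
        have := continuous_T_real α
        fun_prop
      · have h1 : lam * Real.sin α * Real.cosh x ≤ -((lam : ℂ) * T α x - s).re := by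
          linarith [hre x]
        have h2 := hpos x
        rw [norm_div, norm_norm, Real.norm_of_nonneg (h2.le.trans h1), div_div]
        gcongr
        exact hcC x
  have hinv : ∀ t : ℝ, Complex.exp (-(s * t)) • inversion U α lam t = ∫ x, F t x := by
    intro t
    rw [inversion, ← integral_smul]
    simp_rw [hFe]
  simp_rw [hinv]
  refine ⟨hFi.integral_prod_left, ?_⟩
  rw [integral_integral_swap hFi,
    ← integral_resolvent_smul_contourIntegrand hδ hδ' hU hM hlam hα hαδ hs]
  refine integral_congr_ae (Eventually.of_forall fun x => ?_)
  simp only [hF]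
  rw [integral_smul_const, integral_exp_mul_complex_Ioi (hre0 x)]
  congr 1
  rw [Complex.ofReal_zero, mul_zero, Complex.exp_zero, neg_div, one_div, ← inv_neg, neg_sub]

lemma inversion_ae_eq (hδ : 0 < δ) (hδ' : δ < Real.pi / 2)
    (hU : IsSectorial δ M U) (hM : 0 < M) (hlam : 0 < lam) (hα : 0 < α)
    (hαδ : α < Real.pi / 2 - δ) {u : ℝ → X} (hu : IsLaplaceTransform u U) :
    inversion U α lam =ᵐ[volume.restrict (Ioi (0 : ℝ))] u := by
  obtain ⟨ω, hui, huU⟩ := hu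
  -- At `r + m`, `m ∈ ℕ`, both transforms are available; the weight `e^{-rt}` makes the difference
  -- integrable.
  set r := max lam (ω + 1) with hr
  have hrl : lam ≤ r := le_max_left _ _
  have hrω : ω < r := lt_of_lt_of_le (by linarith) (le_max_right _ _)
  have hexp : ∀ (a b t : ℝ), Complex.exp (-((a + b : ℝ) * t)) =
      ((Real.exp (-(b * t)) : ℝ) : ℂ) * Complex.exp (-(a * t)) := by
    intro a b t
    rw [Complex.ofReal_exp, ← Complex.exp_add]
    congr 1
    push_cast
    ring
  have hur : ∀ s : ℝ, ω ≤ s →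
      IntegrableOn (fun t : ℝ => Complex.exp (-(s * t)) • u t) (Ioi 0) := by
    intro s hs
    have e : ∀ t : ℝ, Complex.exp (-(s * t)) • u t =
        Real.exp (-((s - ω) * t)) • Complex.exp (-(ω * t)) • u t := by
      intro t
      rw [← Complex.coe_smul, smul_smul, ← hexp, add_sub_cancel]
    simp_rw [e]
    refine hui.norm.mono' ?_ ?_
    · exact (show Continuous fun t : ℝ => Real.exp (-((s - ω) * t)) by
        fun_prop).aestronglyMeasurable.smul hui.aestronglyMeasurable
    · filter_upwards [ae_restrict_mem measurableSet_Ioi] with t ht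
      rw [norm_smul, Real.norm_of_nonneg (Real.exp_pos _).le]
      refine mul_le_of_le_one_left (norm_nonneg _) ?_
      rw [Real.exp_le_one_iff]
      have := mul_nonneg (sub_nonneg.2 hs) (le_of_lt ht)
      linarith
  have hinv := fun s hs => laplace_inversion (s := s) hδ hδ' hU hM hlam hα hαδ hs
  have hmain := ae_eq_zero_of_laplace_nat
    (F := fun t => Complex.exp (-(r * t)) • inversion U α lam t - Complex.exp (-(r * t)) • u t)
    ((hinv r hrl).1.sub (hur r hrω.le)) (fun m => by
      have hm : lam ≤ r + m := hrl.trans (by simp)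
      have hm' : ω < r + m := hrω.trans_le (by simp)
      have e : ∀ t : ℝ, Real.exp (-t) ^ m • (Complex.exp (-(r * t)) • inversion U α lam t -
          Complex.exp (-(r * t)) • u t) =
          Complex.exp (-((r + m : ℝ) * t)) • inversion U α lam t -
          Complex.exp (-((r + m : ℝ) * t)) • u t := by
        intro t
        rw [hexp, smul_sub, mul_smul, mul_smul, ← Real.exp_nat_mul, Complex.coe_smul,
          Complex.coe_smul, mul_neg]
      simp_rw [e]
      rw [integral_sub (hinv _ hm).1 (hur _ hm'.le), (hinv _ hm).2,
        huU _ (by simpa using hm'), sub_self])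
  rw [Filter.EventuallyEq, ae_restrict_iff' measurableSet_Ioi]
  filter_upwards [hmain] with t ht ht0
  have := ht ht0
  rw [← smul_sub, smul_eq_zero] at this
  exact sub_eq_zero.1 (this.resolve_left (Complex.exp_ne_zero _))

/-- Independence of the contour comes from uniqueness of the Laplace transform, not from a further
deformation: both sides are continuous and equal `u` a.e. -/
lemma inversion_eq (hδ : 0 < δ) (hδ' : δ < Real.pi / 2)
    (hU : IsSectorial δ M U) (hM : 0 < M) (hlam : 0 < lam) (hα : 0 < α)
    (hαδ : α < Real.pi / 2 - δ) {lam' α' : ℝ} (hlam' : 0 < lam') (hα' : 0 < α')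
    (hαδ' : α' < Real.pi / 2 - δ) {u : ℝ → X} (hu : IsLaplaceTransform u U) :
    EqOn (inversion U α lam) (inversion U α' lam') (Ioi 0) :=
  Measure.eqOn_open_of_ae_eq
    ((inversion_ae_eq hδ hδ' hU hM hlam hα hαδ hu).trans
      (inversion_ae_eq hδ hδ' hU hM hlam' hα' hαδ' hu).symm) isOpen_Ioi
    (continuousOn_inversion hδ hδ' hU hM hlam hα hαδ)
    (continuousOn_inversion hδ hδ' hU hM hlam' hα' hαδ')

end Resolvent

end

/-! ### Quadrature error and amplification for the inversion integral. -/

section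

variable {X : Type*} [NormedAddCommGroup X] [NormedSpace ℂ X]
variable {δ M : ℝ} {U : ℂ → X} {α d lam : ℝ}

lemma phi_nonneg (α d : ℝ) : 0 ≤ phi α d := by
  have := Real.pi_pos
  unfold phi
  positivity

lemma weight_smul (U : ℂ → X) (α h lam t : ℝ) (k : ℤ) :
    weight α h lam t k • U (node α h lam k) =
      (h : ℂ) • contourIntegrand U α lam t ((k * h : ℝ) : ℂ) := by
  rw [weight, node, contourIntegrand, deriv_T, smul_smul]
  push_cast
  congr 1
  ring

lemma norm_contourIntegrand_strip_le (hδ : 0 < δ) (hδ' : δ < Real.pi / 2)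
    (hU : IsSectorial δ M U) (hM : 0 < M) (hlam : 0 < lam) (hdα : 0 < α - d)
    (hαd : α + d < Real.pi / 2 - δ) (t : ℝ) {β : ℝ} (hβ1 : α - d ≤ β)
    (hβ2 : β ≤ α + d) (x : ℝ) :
    ‖contourIntegrand U β lam t x‖ ≤ M * phi α d / 4 * Real.exp (lam * t) *
      Real.exp (-(lam * t * Real.sin β * Real.cosh x)) := by
  have hβ := sin_lt_cos (β := β) hδ (by linarith) (by linarith)
  have hs := sin_mem_Ioo (α := α + d) (by linarith) (by linarith)
  have hle : Real.sin β ≤ Real.sin (α + d) :=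
    Real.sin_le_sin_of_le_of_le_pi_div_two (by linarith) (by linarith) hβ2
  refine (norm_contourIntegrand_le hδ hδ' hU hM hlam hβ hle hs.1.le hs.2 t x).trans (le_of_eq ?_)
  rw [mul_assoc _ (Real.exp (lam * t)), ← Real.exp_add, phi]
  congr 1
  · have := Real.pi_ne_zero
    field_simp
    ring
  · congr 1; ring

/-- The error of the truncated trapezoidal rule for the inversion integral. -/
lemma norm_inversion_sub_sum_le [CompleteSpace X] (hδ : 0 < δ) (hδ' : δ < Real.pi / 2)
    (hU : IsSectorial δ M U) (hM : 0 < M) (hlam : 0 < lam) (hd : 0 < d) (hdα : 0 < α - d)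
    (hαd : α + d < Real.pi / 2 - δ) {t : ℝ} (ht : 0 < t) {h : ℝ} (hh : 0 < h) (n : ℕ) :
    ‖inversion U α lam t - ∑ k ∈ Finset.Icc (-(n : ℤ)) n,
        (h : ℂ) • contourIntegrand U α lam t ((k * h : ℝ) : ℂ)‖ ≤
      M * phi α d * (L (lam * t * Real.sin (α - d)) * (Real.exp (lam * t) *
        (Real.exp (-(2 * Real.pi * (d / h))) / (1 - Real.exp (-(2 * Real.pi * (d / h)))))) +
      L (lam * t * Real.sin α) *
        Real.exp (lam * t * (1 - Real.sin α * Real.cosh (n * h)))) := by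
  set C := M * phi α d / 4 * Real.exp (lam * t) with hC
  have hC0 : 0 ≤ C := by have := phi_nonneg α d; positivity
  obtain ⟨hs0, _⟩ := sin_mem_Ioo (α := α - d) hdα (by linarith)
  obtain ⟨hsα, _⟩ := sin_mem_Ioo (α := α) (by linarith) (by linarith)
  set γ := lam * t * Real.sin (α - d) with hγ
  have hγ0 : 0 < γ := by positivity
  have hγα : 0 < lam * t * Real.sin α := by positivity
  have hh0 : (h : ℂ) ≠ 0 := by exact_mod_cast hh.ne'
  have hstrip : ∀ x y : ℝ, |y| ≤ d → ‖contourIntegrand U α lam t (x + y * Complex.I)‖ ≤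
      C * Real.exp (-(γ * Real.cosh x)) := by
    intro x y hy
    obtain ⟨hy1, hy2⟩ := abs_le.1 hy
    rw [contourIntegrand_add_mul_I]
    refine (norm_contourIntegrand_strip_le (β := α - y) hδ hδ' hU hM hlam hdα hαd t
      (by linarith) (by linarith) x).trans ?_
    refine mul_le_mul_of_nonneg_left (Real.exp_le_exp.2 (neg_le_neg ?_)) hC0
    rw [hγ]
    have : Real.sin (α - d) ≤ Real.sin (α - y) :=
      Real.sin_le_sin_of_le_of_le_pi_div_two (by linarith) (by linarith) (by linarith)
    have hc := Real.cosh_pos x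
    gcongr
  -- Rescaled to unit step, which makes the half width of the strip `d/h`.
  set g : ℂ → X := fun w => (h : ℂ) • contourIntegrand U α lam t (h * w) with hg
  have hgxy : ∀ x y : ℝ, g (x + y * Complex.I) =
      (h : ℂ) • contourIntegrand U α lam t ((h * x : ℝ) + (h * y : ℝ) * Complex.I) := by
    intro x y
    simp only [hg]
    congr 2
    push_cast
    ring
  have hyd : ∀ y : ℝ, |y| ≤ d / h → |h * y| ≤ d := fun y hy => by
    rwa [abs_mul, abs_of_pos hh, mul_comm, ← le_div_iff₀ hh]
  have hgle : ∀ x y : ℝ, |y| ≤ d / h → ‖g (x + y * Complex.I)‖ ≤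
      h * (C * Real.exp (-(γ * Real.cosh (h * x)))) := by
    intro x y hy
    rw [hgxy, norm_smul, Complex.norm_of_nonneg hh.le]
    exact mul_le_mul_of_nonneg_left (hstrip _ _ (hyd y hy)) hh.le
  have hdiff : DifferentiableOn ℂ g {z | |z.im| ≤ d / h} := by
    intro w hw
    have hw' := abs_le.1 (hyd _ hw)
    have hsec := smul_T_notMem_sector (β := α - h * w.im) hδ hδ' hlam
      (sin_lt_cos hδ (by linarith) (by linarith)) (h * w.re)
    rw [← T_add_mul_I] at hsec
    have hwe : (((h * w.re : ℝ) : ℂ) + (h * w.im : ℝ) * Complex.I) = h * w := by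
      conv_rhs => rw [← Complex.re_add_im w]
      push_cast
      ring
    rw [hwe] at hsec
    refine DifferentiableAt.differentiableWithinAt (DifferentiableAt.const_smul ?_ _)
    exact DifferentiableAt.comp (g := contourIntegrand U α lam t) (f := fun w : ℂ => (h : ℂ) * w) w
      (differentiableAt_contourIntegrand hδ hδ' hU t hsec) (differentiableAt_id.const_mul _)
  have hdec : ∀ x y : ℝ, |y| ≤ d / h → ‖g (x + y * Complex.I)‖ ≤
      (h * (C * (2 / γ * (1 + (h ^ 2)⁻¹)))) * (1 + x ^ 2)⁻¹ := by
    intro x y hy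
    refine (hgle x y hy).trans ?_
    rw [mul_assoc h, mul_assoc C, mul_assoc (2 / γ)]
    refine mul_le_mul_of_nonneg_left (mul_le_mul_of_nonneg_left
      ((exp_neg_mul_cosh_le hγ0 _).trans (mul_le_mul_of_nonneg_left ?_ (by positivity))) hC0) hh.le
    rw [← div_eq_mul_inv, inv_eq_one_div, div_le_div_iff₀ (by positivity) (by positivity)]
    have e : (1 + (h ^ 2)⁻¹) * (1 + (h * x) ^ 2) = 1 + x ^ 2 + ((h ^ 2)⁻¹ + (h * x) ^ 2) := by
      field_simp
      ring
    rw [e]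
    have : 0 ≤ (h ^ 2)⁻¹ + (h * x) ^ 2 := by positivity
    linarith
  have hscale : Integrable fun x : ℝ => Real.exp (-(γ * Real.cosh (h * x))) :=
    (integrable_exp_neg_mul_cosh hγ0).comp_mul_left' hh.ne'
  have hN : ∀ y : ℝ, |y| = d / h → ∫ x : ℝ, ‖g (x + y * Complex.I)‖ ≤ C * (2 * L γ) := by
    intro y hy
    calc _ ≤ ∫ x : ℝ, h * (C * Real.exp (-(γ * Real.cosh (h * x)))) :=
          integral_mono (integrable_line hdiff hdec hy.le).norm
            ((hscale.const_mul C).const_mul h) fun x => hgle x y hy.le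
      _ = C * ∫ x : ℝ, Real.exp (-(γ * Real.cosh x)) := by
          rw [integral_const_mul, integral_const_mul, Measure.integral_comp_mul_left
            (fun x => Real.exp (-(γ * Real.cosh x))) h, abs_of_pos (inv_pos.2 hh), smul_eq_mul]
          field_simp
      _ ≤ _ := mul_le_mul_of_nonneg_left (integral_line_exp_neg_mul_cosh_le hγ0) hC0
  have htrap := norm_tsum_sub_integral_le (div_pos hd hh) hdiff hdec hN
  have hgk : ∀ x : ℝ, g x = (h : ℂ) • contourIntegrand U α lam t ((x * h : ℝ) : ℂ) := by
    intro x
    simp only [hg]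
    congr 2
    push_cast
    ring
  have hgint : ∫ x : ℝ, g x = inversion U α lam t := by
    simp_rw [hgk]
    rw [integral_smul, Measure.integral_comp_mul_right
      (fun x : ℝ => contourIntegrand U α lam t (x : ℂ)) h, abs_of_pos (inv_pos.2 hh),
      ← Complex.coe_smul, smul_smul, Complex.ofReal_inv, mul_inv_cancel₀ hh0, one_smul, inversion]
  have hd0 : |(0 : ℝ)| ≤ d / h := by rw [abs_zero]; positivity
  have hsum : Summable fun k : ℤ => g k := by
    refine summable_int_of_le_inv_one_add_sq (C := h * (C * (2 / γ * (1 + (h ^ 2)⁻¹)))) fun k => ?_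
    simpa using hdec k 0 hd0
  have hreal : ∀ x : ℝ, ‖(h : ℂ) • contourIntegrand U α lam t (x : ℂ)‖ ≤
      h * (C * Real.exp (-(lam * t * Real.sin α * Real.cosh x))) := by
    intro x
    rw [norm_smul, Complex.norm_of_nonneg hh.le]
    exact mul_le_mul_of_nonneg_left (norm_contourIntegrand_strip_le hδ hδ' hU hM hlam hdα hαd t
      (by linarith) (by linarith) x) hh.le
  have htail : ∀ (e : ℤ) (_ : e = 1 ∨ e = -1) (N : ℕ),
      ∑ j ∈ Finset.range N, ‖g ((e * ((j : ℤ) + n + 1) : ℤ) : ℂ)‖ ≤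
      C * (2 * L (lam * t * Real.sin α) *
        Real.exp (-(lam * t * Real.sin α * Real.cosh (n * h)))) := by
    intro e he N
    refine le_trans ?_ (mul_le_mul_of_nonneg_left
      (mul_sum_exp_neg_mul_cosh_tail_le hγα hh n N) hC0)
    rw [Finset.mul_sum, Finset.mul_sum]
    refine Finset.sum_le_sum fun j _ => ?_
    rw [← Complex.ofReal_intCast, hgk]
    refine (hreal _).trans (le_of_eq ?_)
    have : Real.cosh (((e * ((j : ℤ) + n + 1) : ℤ) : ℝ) * h) = Real.cosh ((j + n + 1) * h) := by
      rcases he with rfl | rfl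
      · push_cast; rw [one_mul]
      · push_cast; rw [neg_one_mul, neg_mul, Real.cosh_neg]
    rw [this]
    ring
  have htr := norm_tsum_sub_sum_Icc_le hsum n
    (fun N => by simpa using htail 1 (Or.inl rfl) N) (fun N => by simpa using htail (-1) (Or.inr rfl) N)
  have hfin : ∑ k ∈ Finset.Icc (-(n : ℤ)) n, g k = ∑ k ∈ Finset.Icc (-(n : ℤ)) n,
      (h : ℂ) • contourIntegrand U α lam t ((k * h : ℝ) : ℂ) := by
    refine Finset.sum_congr rfl fun k _ => ?_
    rw [← Complex.ofReal_intCast, hgk]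
  rw [hgint] at htrap
  rw [hfin] at htr
  have hexp : Real.exp (lam * t) * Real.exp (-(lam * t * Real.sin α * Real.cosh (n * h))) =
      Real.exp (lam * t * (1 - Real.sin α * Real.cosh (n * h))) := by
    rw [← Real.exp_add]; congr 1; ring
  have htri := norm_sub_le_norm_sub_add_norm_sub (inversion U α lam t) (∑' k : ℤ, g k)
    (∑ k ∈ Finset.Icc (-(n : ℤ)) n, (h : ℂ) • contourIntegrand U α lam t ((k * h : ℝ) : ℂ))
  rw [norm_sub_rev (inversion U α lam t) (∑' k : ℤ, g k)] at htri
  refine htri.trans ((add_le_add htrap htr).trans (le_of_eq ?_))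
  rw [← hexp, hC]
  ring

/-- The amplification factor of a relative error. -/
lemma sum_norm_contourIntegrand_le (hδ : 0 < δ) (hδ' : δ < Real.pi / 2)
    (hU : IsSectorial δ M U) (hM : 0 < M) (hlam : 0 < lam) (hd : 0 < d) (hdα : 0 < α - d)
    (hαd : α + d < Real.pi / 2 - δ) {t : ℝ} (ht : 0 < t) {h : ℝ} (hh : 0 < h) (n : ℕ) :
    ∑ k ∈ Finset.Icc (-(n : ℤ)) n, ‖(h : ℂ) • contourIntegrand U α lam t ((k * h : ℝ) : ℂ)‖ ≤
      M * phi α d * (1 / 2 * (h + L (lam * t * Real.sin α))) * Real.exp (lam * t) := by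
  set C := M * phi α d / 4 * Real.exp (lam * t) with hC
  have hC0 : 0 ≤ C := by have := phi_nonneg α d; positivity
  obtain ⟨hsα, _⟩ := sin_mem_Ioo (α := α) (by linarith) (by linarith)
  set γ := lam * t * Real.sin α with hγ
  have hγ0 : 0 < γ := by positivity
  have hreal : ∀ k : ℤ, ‖(h : ℂ) • contourIntegrand U α lam t ((k * h : ℝ) : ℂ)‖ ≤
      C * (h * Real.exp (-(γ * Real.cosh (k * h)))) := by
    intro k
    rw [norm_smul, Complex.norm_of_nonneg hh.le, mul_left_comm]
    exact mul_le_mul_of_nonneg_left (norm_contourIntegrand_strip_le hδ hδ' hU hM hlam hdα hαd t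
      (by linarith) (by linarith) _) hh.le
  refine (Finset.sum_le_sum fun k _ => hreal k).trans ?_
  rw [← Finset.mul_sum, ← Finset.mul_sum, sum_Icc_neg_eq]
  have h1 := mul_sum_exp_neg_mul_cosh_le hγ0 hh n
  have h0 : h * Real.exp (-γ) ≤ h := mul_le_of_le_one_right hh.le (exp_neg_lt_one hγ0).le
  have e : ∑ j ∈ Finset.range n, (Real.exp (-(γ * Real.cosh (((j + 1 : ℤ) : ℝ) * h))) +
      Real.exp (-(γ * Real.cosh (((-(j + 1) : ℤ) : ℝ) * h)))) =
      2 * ∑ j ∈ Finset.range n, Real.exp (-(γ * Real.cosh ((j + 1) * h))) := by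
    rw [Finset.mul_sum]
    refine Finset.sum_congr rfl fun j _ => ?_
    push_cast
    rw [neg_mul, Real.cosh_neg]
    ring
  rw [e, Int.cast_zero, zero_mul, Real.cosh_zero, mul_one]
  calc _ ≤ C * (2 * h + 2 * L γ) := by
        refine mul_le_mul_of_nonneg_left ?_ hC0
        linarith
    _ = _ := by rw [hC]; ring

lemma norm_weight_le (hlam : 0 < lam) {h : ℝ} (hh : 0 < h) (t : ℝ) (k : ℤ) :
    ‖weight α h lam t k‖ ≤ lam * h / (2 * Real.pi) * (Real.cosh (k * h) *
      Real.exp (lam * t * (1 - Real.sin α * Real.cosh (k * h)))) := by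
  have hpi := Real.pi_pos
  have e1 : ‖-((lam : ℂ) * h / (2 * Real.pi * Complex.I))‖ = lam * h / (2 * Real.pi) := by
    rw [norm_neg, norm_div, norm_mul, norm_mul, norm_mul, Complex.norm_I,
      Complex.norm_of_nonneg hlam.le, Complex.norm_of_nonneg hpi.le, Complex.norm_two, mul_one,
      Complex.norm_of_nonneg hh.le]
  have e2 : ‖Complex.exp (t * (lam * T α (k * h : ℝ)))‖ =
      Real.exp (lam * t * (1 - Real.sin α * Real.cosh (k * h))) := by
    rw [Complex.norm_exp, Complex.re_ofReal_mul, Complex.re_ofReal_mul, T_re]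
    congr 1; ring
  have e3 := norm_T'_le_cosh α (k * h)
  push_cast at e2 e3
  rw [weight, node, deriv_T, norm_mul, norm_mul, e1, e2, mul_assoc]
  refine mul_le_mul_of_nonneg_left ?_ (by positivity)
  rw [mul_comm]
  gcongr

end

end LaplaceInversion

end

/-! ### Choice of parameters and assembly. -/

theorem theorem2 {X : Type*} [NormedAddCommGroup X] [NormedSpace ℂ X] [CompleteSpace X]
    (δ M : ℝ) (hδ : 0 < δ) (hδ' : δ < Real.pi / 2) (hM : 0 < M)
    (u : ℝ → X) (U : ℂ → X)
    (hu : LaplaceInversion.IsLaplaceTransform u U)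
    (hU : LaplaceInversion.IsSectorial δ M U) :
    -- `v` is the continuous representative of `u` on `(0, ∞)`
    ∃ v : ℝ → X, ContinuousOn v (Set.Ioi 0) ∧
      v =ᵐ[MeasureTheory.volume.restrict (Set.Ioi (0 : ℝ))] u ∧
      ∀ α d : ℝ, 0 < d → 0 < α - d → α + d < Real.pi / 2 - δ →
      ∀ t₀ Λ θ : ℝ, 0 < t₀ → 1 ≤ Λ → 0 < θ → θ < 1 →
      ∀ n : ℕ, 1 ≤ n →
      ∀ h lam ε : ℝ, h = LaplaceInversion.step α Λ θ n →
        lam = LaplaceInversion.scale α d t₀ Λ θ n →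
        ε = LaplaceInversion.eps α d Λ θ n →
      ∀ ρ : ℝ, 0 < ρ → ∀ (w : ℤ → ℝ → ℂ) (V : ℤ → X),
        (LaplaceInversion.AbsoluteError α h lam n (Set.Icc t₀ (Λ * t₀)) ρ U w V →
          ∀ t ∈ Set.Icc t₀ (Λ * t₀),
            ‖v t - LaplaceInversion.computed n w V t‖ ≤
              M * LaplaceInversion.PhiAbs α d * LaplaceInversion.QAbs α d lam t₀ n *
                (ρ / (M * t₀) * ε ^ (θ - 1) + ε ^ θ / (1 - ε))) ∧
        (LaplaceInversion.RelativeError α h lam n (Set.Icc t₀ (Λ * t₀)) ρ U w V →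
          ∀ t ∈ Set.Icc t₀ (Λ * t₀),
            ‖v t - LaplaceInversion.computed n w V t‖ ≤
              M * LaplaceInversion.phi α d * LaplaceInversion.QRel α d h lam t₀ *
                (ρ * ε ^ (θ - 1) + ε ^ θ / (1 - ε))) := by
  open LaplaceInversion in
  have hα₀ : 0 < (Real.pi / 2 - δ) / 2 := by linarith
  have hα₁ : (Real.pi / 2 - δ) / 2 < Real.pi / 2 - δ := by linarith
  -- The representative must be fixed before `α`, `d` and `λ`, so any admissible contour is taken
  -- here; `inversion_eq` exchanges it later.
  refine ⟨inversion U ((Real.pi / 2 - δ) / 2) 1,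
    continuousOn_inversion hδ hδ' hU hM one_pos hα₀ hα₁,
    inversion_ae_eq hδ hδ' hU hM one_pos hα₀ hα₁ hu, ?_⟩
  intro α d hd hdα hαd t₀ Λ θ ht₀ hΛ hθ0 hθ1 n hn h lam ε hh hlam hε ρ hρ w V
  have hpi := Real.pi_pos
  have hα : 0 < α := by linarith
  obtain ⟨hsin0, hsin1⟩ := sin_mem_Ioo hα (by linarith)
  have hθ : 0 < 1 - θ := by linarith
  have hn0 : (0 : ℝ) < n := by exact_mod_cast hn
  have hΛ0 : 0 < Λ := by linarith
  -- the parameters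
  have harg : 1 < Λ / ((1 - θ) * Real.sin α) := by
    rw [one_lt_div (by positivity)]
    nlinarith
  set A := a α Λ θ with hA
  have hcoshA : Real.cosh A = Λ / ((1 - θ) * Real.sin α) := Real.cosh_arcosh harg.le
  have hA0 : 0 < A := by
    refine lt_of_le_of_ne (Real.arcosh_nonneg harg.le) fun h0 => ?_
    rw [← h0, Real.cosh_zero] at hcoshA
    linarith
  have hh' : h = A / n := by rw [hh, step, ← hA]; ring
  have hh0 : 0 < h := by rw [hh']; positivity
  have hnh : n * h = A := by rw [hh']; field_simp
  have hlam0 : 0 < lam := by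
    rw [hlam, scale, ← hA]; positivity
  set K := 2 * Real.pi * (d / h) with hK
  have hK0 : 0 < K := by positivity
  have hlamK : lam * (Λ * t₀) = (1 - θ) * K := by
    rw [hK, hh', hlam, scale, ← hA]
    field_simp
  have hεK : ε = Real.exp (-K) := by
    rw [hε, eps, ← hA, hK, hh']
    congr 1
    field_simp
  have hε1 : ε < 1 := hεK ▸ exp_neg_lt_one hK0
  have hε0 : 0 < ε := hεK ▸ Real.exp_pos _
  have hεθ1 : ε ^ (θ - 1) = Real.exp (lam * (Λ * t₀)) := by
    rw [hεK, ← Real.exp_mul, hlamK]; congr 1; ring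
  have hεθ : ε ^ θ = Real.exp (-(K * θ)) := by
    rw [hεK, ← Real.exp_mul]; congr 1; ring
  have hlamt : ∀ t ∈ Set.Icc t₀ (Λ * t₀), Real.exp (lam * t) ≤ ε ^ (θ - 1) := by
    intro t ht
    rw [hεθ1, Real.exp_le_exp]
    exact mul_le_mul_of_nonneg_left ht.2 hlam0.le
  have hmul : ε ^ (θ - 1) * (ε / (1 - ε)) = ε ^ θ / (1 - ε) := by
    rw [Real.rpow_sub_one hε0.ne']; field_simp
  have htail : ∀ t ∈ Set.Icc t₀ (Λ * t₀),
      Real.exp (lam * t * (1 - Real.sin α * Real.cosh (n * h))) ≤ ε ^ θ / (1 - ε) := by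
    intro t ht
    have h1 : Real.exp (lam * t * (1 - Real.sin α * Real.cosh (n * h))) ≤ ε ^ θ := by
      rw [hεθ, Real.exp_le_exp, hnh, hcoshA]
      have e : 1 - Real.sin α * (Λ / ((1 - θ) * Real.sin α)) = -((Λ - (1 - θ)) / (1 - θ)) := by
        field_simp
        ring
      rw [e]
      have h2 : lam * t₀ * ((Λ - (1 - θ)) / (1 - θ)) ≤ lam * t * ((Λ - (1 - θ)) / (1 - θ)) := by
        have : 0 ≤ (Λ - (1 - θ)) / (1 - θ) := div_nonneg (by linarith) hθ.le
        have := ht.1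
        gcongr
      -- After inserting `λt₀ = (1-θ)K/Λ` this is `θ ≤ 1 - (1-θ)/Λ`, which is where `Λ ≥ 1` enters.
      have h3 : K * θ ≤ lam * t₀ * ((Λ - (1 - θ)) / (1 - θ)) := by
        have h4 : lam * t₀ = (1 - θ) * K / Λ := by
          rw [← hlamK]; field_simp
        have h5 : lam * t₀ * ((Λ - (1 - θ)) / (1 - θ)) = K * ((Λ - (1 - θ)) / Λ) := by
          rw [h4]; field_simp
        rw [h5]
        refine mul_le_mul_of_nonneg_left ?_ hK0.le
        rw [le_div_iff₀ hΛ0]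
        nlinarith
      linarith
    refine h1.trans ?_
    rw [le_div_iff₀ (by linarith)]
    exact mul_le_of_le_one_right (Real.rpow_nonneg hε0.le _) (by linarith)
  -- comparison of the logarithmic factors
  have hsd : 0 < Real.sin (α - d) := (sin_mem_Ioo hdα (by linarith)).1
  have hsdα : Real.sin (α - d) ≤ Real.sin α :=
    Real.sin_le_sin_of_le_of_le_pi_div_two (by linarith) (by linarith) (by linarith)
  set L₀ := L (lam * t₀ * Real.sin (α - d)) with hL₀
  have hL₀1 : 1 ≤ L₀ := one_le_L _
  have hLα : L (lam * t₀ * Real.sin α) ≤ L₀ := L_le_L (by positivity) (by gcongr)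
  have hLt : ∀ t, t₀ ≤ t → ∀ s, 0 < s → L (lam * t * s) ≤ L (lam * t₀ * s) := fun t ht s hs =>
    L_le_L (by positivity) (by gcongr)
  have hφ0 := phi_nonneg α d
  -- the quadrature error
  have hdisc : ∀ t ∈ Set.Icc t₀ (Λ * t₀), ‖inversion U ((Real.pi / 2 - δ) / 2) 1 t -
      ∑ k ∈ Finset.Icc (-(n : ℤ)) n, weight α h lam t k • U (node α h lam k)‖ ≤
      M * phi α d * (2 * L₀) * (ε ^ θ / (1 - ε)) := by
    intro t ht
    have ht0 : 0 < t := ht₀.trans_le ht.1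
    have h1 := norm_inversion_sub_sum_le hδ hδ' hU hM hlam0 hd hdα hαd ht0 hh0 n
    rw [inversion_eq hδ hδ' hU hM one_pos hα₀ hα₁ hlam0 hα (by linarith) hu ht0]
    simp_rw [weight_smul]
    refine h1.trans ?_
    rw [mul_assoc (M * phi α d)]
    refine mul_le_mul_of_nonneg_left ?_ (by positivity)
    rw [← hK, ← hεK, two_mul, add_mul]
    have hr0 : 0 ≤ ε / (1 - ε) := div_nonneg hε0.le (by linarith)
    refine add_le_add ?_ ?_
    · rw [← hmul]
      refine mul_le_mul (hLt t ht.1 _ hsd) ?_ (by positivity) (by linarith)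
      exact mul_le_mul_of_nonneg_right (hlamt t ht) hr0
    · exact mul_le_mul ((hLt t ht.1 _ hsin0).trans hLα) (htail t ht) (Real.exp_pos _).le
        (by linarith)
  have hεnn : 0 ≤ ε ^ θ / (1 - ε) := div_nonneg (Real.rpow_nonneg hε0.le _) (by linarith)
  have hεnn1 : 0 ≤ ε ^ (θ - 1) := Real.rpow_nonneg hε0.le _
  -- Common to both error models: only the bound `B` for the data error differs.
  have hsplit : ∀ t ∈ Set.Icc t₀ (Λ * t₀), ∀ B Q Φ r : ℝ, 2 * L₀ ≤ Q → phi α d ≤ Φ →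
      ‖∑ k ∈ Finset.Icc (-(n : ℤ)) n,
        (weight α h lam t k • U (node α h lam k) - w k t • V k)‖ ≤ B →
      B ≤ M * Φ * Q * (r * ε ^ (θ - 1)) →
      ‖inversion U ((Real.pi / 2 - δ) / 2) 1 t - computed n w V t‖ ≤
        M * Φ * Q * (r * ε ^ (θ - 1) + ε ^ θ / (1 - ε)) := by
    intro t ht B Q Φ r hQ hΦ hB hBle
    have hΦ0 : 0 ≤ Φ := hφ0.trans hΦ
    rw [Finset.sum_sub_distrib] at hB
    refine (norm_sub_le_norm_sub_add_norm_sub _ (∑ k ∈ Finset.Icc (-(n : ℤ)) n,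
      weight α h lam t k • U (node α h lam k)) _).trans ?_
    rw [mul_add, add_comm]
    refine add_le_add (hB.trans hBle) ((hdisc t ht).trans ?_)
    gcongr
  refine ⟨fun hAbs t ht => ?_, fun hRel t ht => ?_⟩
  · have hγ : 0 < lam * t₀ * Real.sin α := by positivity
    set γ := lam * t₀ * Real.sin α with hγdef
    -- The choices of `λ` and `a(θ)` tie the last node to `d`; this is the constraint needed for
    -- large steps.
    have hγh : γ * h * Real.cosh (n * h) = 2 * Real.pi * d := by
      have e : lam * t₀ * Λ = (1 - θ) * (2 * Real.pi * (d / h)) := by rw [← hK, ← hlamK]; ring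
      have e2 : γ * h * Real.cosh (n * h) = lam * t₀ * Λ * h / (1 - θ) := by
        rw [hnh, hcoshA, hγdef]; field_simp
      rw [e2, e]; field_simp
    have hamp := mul_sum_mul_cosh_mul_exp_div_le (α := α) hd (by linarith) (by linarith) hγ hh0 hn hγh
    have hΦ0 : 0 ≤ PhiAbs α d := hφ0.trans (le_max_left _ _)
    have hQ : 2 * L₀ ≤ QAbs α d lam t₀ n := le_max_left _ _
    -- Writing `λ = γ / (t₀ sin α)` produces the `1/t₀` of the scaled absolute error.
    have hw : ∀ k : ℤ, ‖weight α h lam t k‖ ≤ ε ^ (θ - 1) / t₀ * (h / (2 * Real.pi * Real.sin α) *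
        (γ * Real.cosh (k * h) * Real.exp (-(γ * Real.cosh (k * h))))) := by
      intro k
      refine (norm_weight_le hlam0 hh0 t k).trans ?_
      have hc := Real.cosh_pos (k * h)
      have h1 : Real.exp (lam * t * (1 - Real.sin α * Real.cosh (k * h))) ≤
          ε ^ (θ - 1) * Real.exp (-(γ * Real.cosh (k * h))) := by
        have h2 : Real.exp (-(lam * t * Real.sin α * Real.cosh (k * h))) ≤
            Real.exp (-(γ * Real.cosh (k * h))) := by
          rw [Real.exp_le_exp, neg_le_neg_iff, hγdef]
          have := ht.1
          gcongr
        have h3 : Real.exp (lam * t * (1 - Real.sin α * Real.cosh (k * h))) = Real.exp (lam * t) *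
            Real.exp (-(lam * t * Real.sin α * Real.cosh (k * h))) := by
          rw [← Real.exp_add]; congr 1; ring
        rw [h3]
        exact mul_le_mul (hlamt t ht) h2 (Real.exp_pos _).le hεnn1
      calc _ ≤ lam * h / (2 * Real.pi) * (Real.cosh (k * h) *
            (ε ^ (θ - 1) * Real.exp (-(γ * Real.cosh (k * h))))) := by gcongr
        _ = _ := by rw [hγdef]; field_simp
    have hsumw : ∑ k ∈ Finset.Icc (-(n : ℤ)) n, ‖weight α h lam t k‖ ≤
        ε ^ (θ - 1) / t₀ * (PhiAbs α d * (2 * L γ)) := by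
      refine (Finset.sum_le_sum fun k _ => hw k).trans ?_
      rw [← Finset.mul_sum, ← Finset.mul_sum, div_mul_eq_mul_div h]
      exact mul_le_mul_of_nonneg_left hamp (by positivity)
    refine hsplit t ht (ρ * ∑ k ∈ Finset.Icc (-(n : ℤ)) n, ‖weight α h lam t k‖) _ _ _ hQ
      (le_max_left _ _) ?_ ?_
    · rw [Finset.mul_sum]
      refine norm_sum_le_of_le _ fun k hk => ?_
      rw [(hAbs k hk).2 t ht, ← smul_sub, norm_smul, mul_comm]
      exact mul_le_mul_of_nonneg_right (hAbs k hk).1 (norm_nonneg _)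
    · have hL : 2 * L γ ≤ QAbs α d lam t₀ n := le_trans (by linarith) hQ
      calc _ ≤ ρ * (ε ^ (θ - 1) / t₀ * (PhiAbs α d * (2 * L γ))) := by gcongr
        _ ≤ ρ * (ε ^ (θ - 1) / t₀ * (PhiAbs α d * QAbs α d lam t₀ n)) := by gcongr
        _ = _ := by field_simp
  · have ht0 : 0 < t := ht₀.trans_le ht.1
    have hs := sum_norm_contourIntegrand_le hδ hδ' hU hM hlam0 hd hdα hαd ht0 hh0 n
    have hQ0 : 1 / 2 * (h + L (lam * t * Real.sin α)) ≤ QRel α d h lam t₀ :=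
      le_trans (by linarith [hLt t ht.1 _ hsin0]) (le_max_right _ _)
    refine hsplit t ht (ρ * ∑ k ∈ Finset.Icc (-(n : ℤ)) n,
      ‖(h : ℂ) • contourIntegrand U α lam t ((k * h : ℝ) : ℂ)‖) _ _ _ (le_max_left _ _) le_rfl ?_ ?_
    · rw [Finset.mul_sum]
      refine norm_sum_le_of_le _ fun k hk => ?_
      rw [← weight_smul]
      exact hRel k hk t ht
    · have hL0 := one_le_L (lam * t * Real.sin α)
      have hexp := hlamt t ht
      calc _ ≤ ρ * (M * phi α d * (1 / 2 * (h + L (lam * t * Real.sin α))) *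
            Real.exp (lam * t)) := by gcongr
        _ ≤ ρ * (M * phi α d * QRel α d h lam t₀ * ε ^ (θ - 1)) := by
          have : 0 ≤ QRel α d h lam t₀ := le_trans (by positivity) hQ0
          gcongr
        _ = _ := by ring
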